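/- Let $(X,\mathscr B,\mu)$ be a $\sigma$-finite measure space with $\mu(X)=\infty$ and let $T:X\to X$ preserve $\mu$. Let $\widehat T$ be the transfer operator on $L^1(\mu)$, defined by $\int f\,(g\circ T)\,d\mu=\int(\widehat Tf)\,g\,d\mu$ for $f\in L^1(\mu)$, $g\in L^\infty(\mu)$. Assume that $T$ is conservative ergodic, i.e. $\sum_{k\ge0}\widehat T^ku=\infty$ $\mu$-a.e. for every $0\le u\in L^1(\mu)$ with $\int u\,d\mu>0$, and pointwise dual ergodic, i.e. for some real sequence $(a'_n)$ one has $\frac1{a'_n}\sum_{k<n}\widehat T^ku\to\int u\,d\mu$ $\mu$-a.e. for every $u\in L^1(\mu)$. Let $0<\alpha\le1$. Let $Y\in\mathscr B$, $\mu(Y)>0$, be a uniform set with normalizing sequence $(a_n)$, $a_n\ge0$: for some $0\le f\in L^1(\mu)$ with $\int f\,d\mu>0$, $\frac1{a_n}\sum_{k<n}\widehat T^kf\to\int f\,d\mu$ in the $L^\infty$ norm on $Y$. Assume that $a(x):=a_{\lfloor x\rfloor}$ is regularly varying of index $\alpha$ at infinity, i.e. $a(xy)/a(x)\to y^\alpha$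 as $x\to\infty$ for all $y>0$. Let $b:[0,\infty)\to[0,\infty)$ be an asymptotic inverse of $a$, i.e. $b(a(s))\sim a(b(s))\sim s$ as $s\to\infty$, and put $\gamma(s)=1/b(1/s)$. Let $(E_n)$ be measurable sets with $E_n\subset Y$ (modulo $\mu$), $0<\mu(E_n)<\infty$ and $\mu(E_n)\to0$. For $A\in\mathscr B$ let $\Phi_A=(r_A^{(k)})_{k\ge1}\in[0,\infty]^{\mathbb N}$ be the sequence of successive times $m\ge1$ with $T^mx\in A$ ($\inf\emptyset=\infty$). Let $\Psi,\widetilde\Psi$ be random elements of $[0,\infty]^{\mathbb N}$ such that - (hitting limit) $\gamma(\mu(E_n))\,\Phi_{E_n}$ converges in law to $\Psi$ under every probability measure $\nu\ll\mu$; - (return limit) $\gamma(\mu(E_n))\,\Phi_{E_n}$ converges in law to $\widetilde\Psi$ under $\mu_{E_n}=\mu(\,\cdot\cap E_n)/\mu(E_n)$; - almost surely, $\Psi$ and $\widetilde\Psi$ are nondecreasing sequences of finite numbers tending to $\infty$. Let $N=\sum_i\delta_{\Psi^{(i)}}$ and $\widetilde N=\sum_i\delta_{\widetilde\Psi^{(i)}}$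 be the associated point processes on $[0,\infty)$, and for $d\ge0$, $t\ge0$ put $P_N(d,t)=\mathbb P(N[0,t]=d)$, $P_{\widetilde N}(d,t)=\mathbb P(\widetilde N[0,t]=d)$, with $P_{\widetilde N}(-1,\cdot)=0$. For a function $F$ that is absolutely continuous on bounded subintervals of $[0,\infty)$, let its Caputo derivative at $t>0$ be ${}^{\mathrm{Cap}}D^\alpha F(t)=\frac1{\Gamma(1-\alpha)}\int_0^tF'(x)(t-x)^{-\alpha}\,dx$ if $\alpha<1$, and ${}^{\mathrm{Cap}}D^1F(t)=F'(t)$. Then $P_N(0,0)=1$, and for every integer $d\ge0$: the function $P_N(d,\cdot)$ is absolutely continuous on every bounded interval $[0,t]$, and $${}^{\mathrm{Cap}}D^{\alpha}P_N(d,\cdot)(t)=\Gamma(1+\alpha)\bigl(P_{\widetilde N}(d-1,t)-P_{\widetilde N}(d,t)\bigr)$$ at every $t>0$ at which the right-hand side is continuous in $t$, hence for all $t>0$ outside a countable set. At each such $t$ the Caputo derivative exists (the integral converges absolutely if $\alpha<1$; the ordinary derivative exists if $\alpha=1$). -/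

import Mathlib

open MeasureTheory ProbabilityTheory Filter Topology
open scoped ENNReal NNReal

namespace RareEvents

/-! ### Infinite ergodic theory -/

section Ergodic

variable {X : Type*} [MeasurableSpace X]

/-- The transfer operator `T̂` of `T` with respect to `μ`. For `f ≥ 0` it is the density with respect
to `μ` of the push-forward by `T` of the measure `f dμ`; a general `f` is split as `f⁺ - f⁻`. -/
noncomputable def transferOp (T : X → X) (μ : Measure X) (f : X → ℝ) : X → ℝ := fun x =>
  (((μ.withDensity fun y => ENNReal.ofReal (f y)).map T).rnDeriv μ x).toReal -
    (((μ.withDensity fun y => ENNReal.ofReal (-f y)).map T).rnDeriv μ x).toReal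

/-- `T̂` preserves integrability. -/
theorem integrable_transferOp {T : X → X} {μ : Measure X} {f : X → ℝ} (hf : Integrable f μ) :
    Integrable (transferOp T μ f) μ := by
  have h1 := isFiniteMeasure_withDensity_ofReal hf.2
  have h2 := isFiniteMeasure_withDensity_ofReal hf.neg.2
  exact Measure.integrable_toReal_rnDeriv.sub
    (@Measure.integrable_toReal_rnDeriv _ _ _ μ
      (@Measure.isFiniteMeasure_map _ _ _ _ _ h2 T))

theorem integral_toReal_rnDeriv_map_mul {T : X → X} {μ : Measure X} [SigmaFinite μ]
    (hT : MeasurePreserving T μ μ) {f : X → ℝ} (hf : Integrable f μ) {g : X → ℝ}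
    (hg : Measurable g) :
    ∫ x, (((μ.withDensity fun y => ENNReal.ofReal (f y)).map T).rnDeriv μ x).toReal * g x ∂μ =
      ∫ x, (ENNReal.ofReal (f x)).toReal * g (T x) ∂μ := by
  have h1 := isFiniteMeasure_withDensity_ofReal hf.2
  have hac : (μ.withDensity fun y => ENNReal.ofReal (f y)).map T ≪ μ := by
    have := (withDensity_absolutelyContinuous μ fun y => ENNReal.ofReal (f y)).map hT.measurable
    rwa [hT.map_eq] at this
  rw [_root_.MeasureTheory.integral_toReal_rnDeriv_mul hac,
    integral_map hT.measurable.aemeasurable hg.aestronglyMeasurable,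
    integral_withDensity_eq_integral_toReal_smul₀ hf.1.aemeasurable.ennreal_ofReal
      (by simp)]
  rfl

/-- The identity `∫ f · (g ∘ T) dμ = ∫ (T̂ f) · g dμ` that characterizes `T̂`. -/
theorem integral_transferOp_mul {T : X → X} {μ : Measure X} [SigmaFinite μ]
    (hT : MeasurePreserving T μ μ) {f : X → ℝ} (hf : Integrable f μ) {g : X → ℝ}
    (hg : Measurable g) {C : ℝ} (hC : ∀ x, |g x| ≤ C) :
    ∫ x, f x * g (T x) ∂μ = ∫ x, transferOp T μ f x * g x ∂μ := by
  have h1 := isFiniteMeasure_withDensity_ofReal hf.2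
  have h2 : IsFiniteMeasure (μ.withDensity fun y => ENNReal.ofReal (-f y)) :=
    isFiniteMeasure_withDensity_ofReal hf.neg.2
  have e1 := integral_toReal_rnDeriv_map_mul hT hf hg
  have e2 := integral_toReal_rnDeriv_map_mul hT hf.neg hg
  simp only [Pi.neg_apply] at e2
  have i1 : Integrable (fun x =>
      (((μ.withDensity fun y => ENNReal.ofReal (f y)).map T).rnDeriv μ x).toReal * g x) μ :=
    Measure.integrable_toReal_rnDeriv.mul_bdd (c := C) hg.aestronglyMeasurable (ae_of_all _ hC)
  have i2 : Integrable (fun x =>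
      (((μ.withDensity fun y => ENNReal.ofReal (-f y)).map T).rnDeriv μ x).toReal * g x) μ :=
    Measure.integrable_toReal_rnDeriv.mul_bdd (c := C) hg.aestronglyMeasurable (ae_of_all _ hC)
  have hgT : AEStronglyMeasurable (fun x => g (T x)) μ :=
    (hg.comp hT.measurable).aestronglyMeasurable
  have j1 : Integrable (fun x => (ENNReal.ofReal (f x)).toReal * g (T x)) μ := by
    have : Integrable (fun x => (ENNReal.ofReal (f x)).toReal) μ := by
      simpa [ENNReal.toReal_ofReal'] using hf.pos_part
    exact this.mul_bdd (c := C) hgT (ae_of_all _ fun x => hC (T x))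
  have j2 : Integrable (fun x => (ENNReal.ofReal (-f x)).toReal * g (T x)) μ := by
    have : Integrable (fun x => (ENNReal.ofReal (-f x)).toReal) μ := by
      simpa [ENNReal.toReal_ofReal'] using hf.neg_part
    exact this.mul_bdd (c := C) hgT (ae_of_all _ fun x => hC (T x))
  have : ∀ x, transferOp T μ f x * g x =
      (((μ.withDensity fun y => ENNReal.ofReal (f y)).map T).rnDeriv μ x).toReal * g x -
      (((μ.withDensity fun y => ENNReal.ofReal (-f y)).map T).rnDeriv μ x).toReal * g x :=
    fun x => by simp only [transferOp]; ring
  simp_rw [this]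
  rw [integral_sub i1 i2, e1, e2, ← integral_sub j1 j2]
  refine integral_congr_ae (ae_of_all _ fun x => ?_)
  simp only [ENNReal.toReal_ofReal', ← sub_mul]
  congr 1
  rcases le_total 0 (f x) with h | h
  · rw [max_eq_left h, max_eq_right (by linarith)]; ring
  · rw [max_eq_right h, max_eq_left (by linarith)]; ring

/-- `∑_{k < n} T̂^k u`. -/
noncomputable def transferSum (T : X → X) (μ : Measure X) (u : X → ℝ) (n : ℕ) : X → ℝ := fun x =>
  ∑ k ∈ Finset.range n, (transferOp T μ)^[k] u x

/-- Conservative ergodic measure preserving transformation: `∑_k T̂^k u = ∞` almost everywhere for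
every integrable `u ≥ 0` with `∫ u dμ > 0`. -/
structure IsCEMPT (T : X → X) (μ : Measure X) : Prop where
  measurePreserving : MeasurePreserving T μ μ
  tendsto_transferSum : ∀ u : X → ℝ, Integrable u μ → 0 ≤ᵐ[μ] u → 0 < ∫ x, u x ∂μ →
    ∀ᵐ x ∂μ, Tendsto (fun n => transferSum T μ u n x) atTop atTop

/-- Pointwise dual ergodicity. -/
def IsPointwiseDualErgodic (T : X → X) (μ : Measure X) : Prop :=
  ∃ a : ℕ → ℝ, ∀ u : X → ℝ, Integrable u μ →
    ∀ᵐ x ∂μ, Tendsto (fun n => transferSum T μ u n x / a n) atTop (𝓝 (∫ y, u y ∂μ))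

/-- `Y` is a uniform set with normalizing sequence `a`: for some integrable `f ≥ 0` with
`∫ f dμ > 0`, the functions `(1 / a n) ∑_{k < n} T̂^k f` converge to `∫ f dμ` uniformly (modulo
`μ`-null sets) on `Y`. -/
def IsUniformSet (T : X → X) (μ : Measure X) (Y : Set X) (a : ℕ → ℝ) : Prop :=
  MeasurableSet Y ∧ 0 < μ Y ∧
    ∃ f : X → ℝ, Integrable f μ ∧ 0 ≤ᵐ[μ] f ∧ 0 < ∫ x, f x ∂μ ∧
      Tendsto (fun n => eLpNorm (fun x => transferSum T μ f n x / a n - ∫ y, f y ∂μ) ∞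
        (μ.restrict Y)) atTop (𝓝 0)

end Ergodic

/-! ### Regular variation and scaling -/

/-- `a : [0, ∞) → [0, ∞)` is regularly varying of index `α` at infinity (the values of `a` at
negative reals play no role). -/
structure IsRegularlyVarying (a : ℝ → ℝ) (α : ℝ) : Prop where
  measurable : Measurable a
  nonneg : ∀ x, 0 ≤ x → 0 ≤ a x
  tendsto : ∀ y : ℝ, 0 < y → Tendsto (fun x => a (x * y) / a x) atTop (𝓝 (y ^ α))

/-- The function `x ↦ a_⌊x⌋` attached to a sequence. -/
noncomputable def seqFun (a : ℕ → ℝ) : ℝ → ℝ := fun x => a ⌊x⌋₊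

/-- `b : [0, ∞) → [0, ∞)` is an asymptotic inverse of `a`: `b (a s) ∼ a (b s) ∼ s` at infinity. -/
structure IsAsymptoticInverse (a b : ℝ → ℝ) : Prop where
  nonneg : ∀ s, 0 ≤ s → 0 ≤ b s
  left : Asymptotics.IsEquivalent atTop (fun s => b (a s)) (fun s => s)
  right : Asymptotics.IsEquivalent atTop (fun s => a (b s)) (fun s => s)

/-- The scaling function `γ(s) = 1 / b(1 / s)`. -/
noncomputable def scaling (b : ℝ → ℝ) (s : ℝ) : ℝ := 1 / b (1 / s)

/-! ### Processes of return times and convergence in law -/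

section Returns

variable {X : Type*}

/-- `returnTime T A k x` is the time of the `k`-th visit to `A` at a positive time of the orbit of
`x` (it is `0` for `k = 0`, and `⊤ = inf ∅` if there are fewer than `k` visits). -/
noncomputable def returnTime (T : X → X) (A : Set X) : ℕ → X → ℕ∞
  | 0, _ => 0
  | k + 1, x => sInf {m : ℕ∞ | ∃ n : ℕ, m = n ∧ returnTime T A k x < n ∧ T^[n] x ∈ A}

/-- The process `γ(μ(A)) Φ_A`, where `Φ_A = (r_A⁽¹⁾, r_A⁽²⁾, …)`, as a random element of
`[0, ∞]^ℕ`; the coordinate `i : ℕ` carries the `(i + 1)`-st return. -/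
noncomputable def scaledReturns [MeasurableSpace X] (T : X → X) (μ : Measure X) (b : ℝ → ℝ)
    (A : Set X) : X → ℕ → ℝ≥0∞ := fun x i =>
  ENNReal.ofReal (scaling b (μ.real A)) * (returnTime T A (i + 1) x : ℝ≥0∞)

/-- Strong convergence in law `Z n ⇒ Z∞` with respect to a possibly infinite measure `μ`:
convergence in law under every probability measure absolutely continuous with respect to `μ`. -/
def TendstoStronglyInLaw [MeasurableSpace X] {E Ω : Type*} [TopologicalSpace E] [MeasurableSpace E]
    [OpensMeasurableSpace E] [MeasurableSpace Ω] (μ : Measure X) (Z : ℕ → X → E) (Zlim : Ω → E)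
    (P : Measure Ω) [IsProbabilityMeasure P] : Prop :=
  ∀ (ν : Measure X) [IsProbabilityMeasure ν], ν ≪ μ →
    TendstoInDistribution Z atTop Zlim (fun _ => ν) P

end Returns

/-! ### Point processes -/

/-- The set of nondecreasing sequences of finite numbers in `[0, ∞)` that tend to `∞`. -/
def locallyFinitePaths : Set (ℕ → ℝ≥0∞) :=
  {φ | (∀ i, φ i ≠ ∞) ∧ Monotone φ ∧ Tendsto φ atTop (𝓝 ∞)}

open Classical in
/-- The map `Ξ` that sends `(φ⁽ⁱ⁾)` to the atomic measure `∑ δ_{φ⁽ⁱ⁾}` on `[0, ∞)` if `(φ⁽ⁱ⁾)` is a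
nondecreasing finite sequence tending to infinity, and to `0` otherwise. -/
noncomputable def toPointMeasure (φ : ℕ → ℝ≥0∞) : Measure ℝ≥0 :=
  if φ ∈ locallyFinitePaths then Measure.sum fun i => Measure.dirac (φ i).toNNReal else 0

/-- `P_N(d, t) = ℙ(N[0, t] = d)` for a point process `N` on `[0, ∞)` and `t ≥ 0`, with
`P_N(d, ·) = 0` for `d < 0`. -/
noncomputable def countProb {Ω : Type*} [MeasurableSpace Ω] (P : Measure Ω) (N : Ω → Measure ℝ≥0)
    (d : ℤ) (t : ℝ) : ℝ :=
  if d < 0 then 0 else P.real {ω | N ω (Set.Icc 0 t.toNNReal) = (d.toNat : ℝ≥0∞)}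

/-! ### Fractional calculus -/

/-- The Riemann–Liouville integral `(I^β f)(t) = Γ(β)⁻¹ ∫₀ᵗ f(x) (t - x)^(β - 1) dx`, for `β > 0`. -/
noncomputable def riemannLiouville (β : ℝ) (f : ℝ → ℝ) (t : ℝ) : ℝ :=
  1 / Real.Gamma β * ∫ x in (0 : ℝ)..t, f x * (t - x) ^ (β - 1)

/-- For `0 < β ≤ 1`, the Caputo derivative of order `β` of `f` exists at `t > 0` and equals `v`: for
`β < 1` this means that the integral defining `I^(1 - β) f'` at `t` converges absolutely and has the
value `v`; for `β = 1` the Caputo derivative is the ordinary derivative (`I^0` is the identity).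
For `β < 1` it is meant for functions that are absolutely continuous on `[0, t]`, whose derivative
exists almost everywhere. -/
def HasCaputoDerivAt (β : ℝ) (f : ℝ → ℝ) (v t : ℝ) : Prop :=
  (β < 1 ∧ IntervalIntegrable (fun x => deriv f x * (t - x) ^ ((1 - β) - 1)) volume 0 t ∧
    riemannLiouville (1 - β) (deriv f) t = v) ∨
  (β = 1 ∧ HasDerivAt f v t)

end RareEvents

/-! Let `f` witness that `Y` is uniform, `c = ∫ f dμ` and `S_j = ∑_{k < j} T̂^k f`. If an orbit
visits `A` at least `d + 1` times up to time `m`, exactly one of these visits is followed by exactly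
`d` further ones up to `m` (`visitInd_eq_sum`). Integrating this partition against `f` and moving
the iterates of `T` onto `f` by duality (`integral_mul_visitInd`) gives ∫ f 1{r⁽ᵈ⁺¹⁾ ≤ m} dμ = ∫_A
S_{(m - r⁽ᵈ⁾)₊ + 1} dμ - ∫_A S_{(m - r⁽ᵈ⁺¹⁾)₊ + 1} dμ.

Take `A = E_n`, `γ = γ(μ(E_n))`, `m = ⌊t / γ⌋`. By uniformity and regular variation, `μ(E_n) S_j` is
close to `c (j γ)^α`, uniformly on `Y` and over bounded `j γ`
(`eventually_ae_forall_abs_transferSum_sub_le`). Hence the return limit controls the right side,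
while the hitting limit under the law `f dμ / c` controls the left. The outcome is
`coordLaw_real_Iic_eq_sub`: ℙ(Ψ⁽ᵈ⁺¹⁾ ≤ t) = H_d(t) - H_{d+1}(t), where H_d(t) = 𝔼 (t - Ψ̃⁽ᵈ⁾)₊^α and
Ψ̃⁽⁰⁾ = 0.

With `Ψ⁽⁰⁾ = 0`, `P_N(d, t)` is `ℙ(Ψ⁽ᵈ⁾ ≤ t) - ℙ(Ψ⁽ᵈ⁺¹⁾ ≤ t)` (`countProb_eq_sub`), so it is a
second difference of the `H_d`, plus the constant `1` when `d = 0`. By Fubini and the Beta integral,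
`H_d` is `Γ(1 + α)` times the fractional integral of order `α` of the distribution function of
`Ψ̃⁽ᵈ⁾` (`isFractionalPrimitive_powPotential`). The Caputo derivative undoes that integral and
leaves a second difference of distribution functions, which is the asserted difference of `P_Ñ`. -/

namespace RareEvents

/-! ### Fractional integrals of distribution functions and their Caputo derivatives. -/

section Fractional

/-- The Beta integral over `[0, a]`. -/
theorem integral_rpow_mul_sub_rpow {p q a : ℝ} (hp : 0 < p) (hq : 0 < q) (ha : 0 < a) :
    ∫ x in (0 : ℝ)..a, x ^ (p - 1) * (a - x) ^ (q - 1) =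
      a ^ (p + q - 1) * beta p q := by
  have h := Complex.betaIntegral_scaled (p : ℂ) (q : ℂ) ha
  have hl : ∫ x in (0 : ℝ)..a, (x : ℂ) ^ ((p : ℂ) - 1) * ((a : ℂ) - x) ^ ((q : ℂ) - 1) =
      ((∫ x in (0 : ℝ)..a, x ^ (p - 1) * (a - x) ^ (q - 1) : ℝ) : ℂ) := by
    rw [← intervalIntegral.integral_ofReal]
    refine intervalIntegral.integral_congr fun x hx => ?_
    rw [Set.uIcc_of_le ha.le] at hx
    rw [Complex.ofReal_mul, Complex.ofReal_cpow hx.1, Complex.ofReal_cpow (by linarith [hx.2])]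
    push_cast
    rfl
  rw [hl] at h
  have h2 := congrArg Complex.re h
  rw [Complex.ofReal_re] at h2
  rw [h2, beta_eq_betaIntegralReal p q hp hq]
  have : (a : ℂ) ^ ((p : ℂ) + q - 1) = ((a ^ (p + q - 1) : ℝ) : ℂ) := by
    rw [Complex.ofReal_cpow ha.le]; push_cast; rfl
  rw [this, Complex.re_ofReal_mul]

theorem integral_sub_rpow_mul_sub_rpow {p q x t : ℝ} (hp : 0 < p) (hq : 0 < q) (hxt : x < t) :
    ∫ s in x..t, (s - x) ^ (p - 1) * (t - s) ^ (q - 1) = (t - x) ^ (p + q - 1) * beta p q := by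
  rw [← integral_rpow_mul_sub_rpow hp hq (sub_pos.2 hxt)]
  have := intervalIntegral.integral_comp_sub_right
    (fun s => s ^ (p - 1) * (t - x - s) ^ (q - 1)) (a := x) (b := t) x
  simp only [sub_self] at this
  rw [← this]
  refine intervalIntegral.integral_congr fun s _ => ?_
  rw [show t - x - (s - x) = t - s by ring]

theorem intervalIntegrable_sub_rpow_mul_sub_rpow {p q x t : ℝ} (hp : 0 < p) (hq : 0 < q)
    (hxt : x < t) :
    IntervalIntegrable (fun s => (s - x) ^ (p - 1) * (t - s) ^ (q - 1)) volume x t := by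
  refine intervalIntegral.intervalIntegrable_of_integral_ne_zero ?_
  rw [integral_sub_rpow_mul_sub_rpow hp hq hxt]
  exact (mul_pos (Real.rpow_pos_of_pos (sub_pos.2 hxt) _) (beta_pos hp hq)).ne'

/-- The derivative in `s` of `(s - x)_+ ^ α`. -/
noncomputable def powDensity (α x s : ℝ) : ℝ := if x < s then α * (s - x) ^ (α - 1) else 0

theorem powDensity_nonneg {α : ℝ} (hα : 0 < α) (x s : ℝ) : 0 ≤ powDensity α x s := by
  unfold powDensity
  split_ifs with h
  · exact mul_nonneg hα.le (Real.rpow_nonneg (sub_nonneg.2 h.le) _)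
  · exact le_rfl

theorem measurable_powDensity (α : ℝ) : Measurable fun z : ℝ × ℝ => powDensity α z.1 z.2 := by
  unfold powDensity
  refine Measurable.ite (measurableSet_lt measurable_fst measurable_snd) ?_ measurable_const
  fun_prop

/-- `∫ (t - x)_+ ^ α dρ(x)`. -/
noncomputable def powPotential (α : ℝ) (ρ : Measure ℝ) (t : ℝ) : ℝ := ∫ x, max (t - x) 0 ^ α ∂ρ

/-- The density of `powPotential`. -/
noncomputable def powPotentialDensity (α : ℝ) (ρ : Measure ℝ) (s : ℝ) : ℝ :=
  ∫ x, powDensity α x s ∂ρ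

theorem powDensity_mul_eq_indicator {α q x t s : ℝ} (hs : s ≤ t) :
    powDensity α x s * (t - s) ^ (q - 1) =
      (Set.Ioc x t).indicator (fun s => α * ((s - x) ^ (α - 1) * (t - s) ^ (q - 1))) s := by
  by_cases h : x < s
  · rw [Set.indicator_of_mem (show s ∈ Set.Ioc x t from ⟨h, hs⟩), powDensity, if_pos h, mul_assoc]
  · rw [Set.indicator_of_notMem (fun h' => h h'.1), powDensity, if_neg h, zero_mul]

theorem integrableOn_powDensity_mul {α q x t : ℝ} (hα : 0 < α) (hq : 0 < q) :
    IntegrableOn (fun s => powDensity α x s * (t - s) ^ (q - 1)) (Set.Ioc 0 t) := by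
  refine IntegrableOn.congr_fun ?_ (fun s hs => (powDensity_mul_eq_indicator hs.2).symm)
    measurableSet_Ioc
  refine Integrable.integrableOn (IntegrableOn.integrable_indicator ?_ measurableSet_Ioc)
  rcases lt_or_ge x t with hxt | hxt
  · exact ((intervalIntegrable_sub_rpow_mul_sub_rpow hα hq hxt).const_mul α).1
  · simp [hxt]

theorem integral_powDensity_mul {α q x t : ℝ} (hα : 0 < α) (hq : 0 < q) (hx : 0 ≤ x) :
    ∫ s in Set.Ioc 0 t, powDensity α x s * (t - s) ^ (q - 1) =
      if x < t then (t - x) ^ (α + q - 1) * (α * beta α q) else 0 := by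
  rw [setIntegral_congr_fun measurableSet_Ioc fun s hs => powDensity_mul_eq_indicator hs.2,
    setIntegral_indicator measurableSet_Ioc,
    Set.inter_eq_right.2 (Set.Ioc_subset_Ioc_left hx)]
  split_ifs with hxt
  · rw [← intervalIntegral.integral_of_le hxt.le, intervalIntegral.integral_const_mul,
      integral_sub_rpow_mul_sub_rpow hα hq hxt]
    ring
  · simp [not_lt.1 hxt]

/-- This licenses Fubini. The condition `1 ≤ α + q` makes the exponent of `t - x` in the inner
integral nonnegative, so that integral is bounded uniformly in `x ≥ 0`. -/
theorem integrable_prod_powDensity_mul {α q t : ℝ} (hα : 0 < α) (hq : 0 < q) (hαq : 1 ≤ α + q)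
    (ρ : Measure ℝ) [IsProbabilityMeasure ρ] (hρ : ∀ᵐ x ∂ρ, 0 ≤ x) :
    Integrable (fun z : ℝ × ℝ => powDensity α z.1 z.2 * (t - z.2) ^ (q - 1))
      (ρ.prod (volume.restrict (Set.Ioc 0 t))) := by
  have hm : Measurable fun z : ℝ × ℝ => powDensity α z.1 z.2 * (t - z.2) ^ (q - 1) :=
    (measurable_powDensity α).mul (by fun_prop)
  rw [integrable_prod_iff hm.aestronglyMeasurable]
  refine ⟨ae_of_all _ fun x => integrableOn_powDensity_mul hα hq, ?_⟩
  have hbound : ∀ x : ℝ, 0 ≤ x → ‖∫ s in Set.Ioc 0 t,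
      ‖powDensity α x s * (t - s) ^ (q - 1)‖‖ ≤ |t| ^ (α + q - 1) * (α * beta α q) := by
    intro x hx
    have hc : 0 ≤ α * beta α q := mul_nonneg hα.le (beta_pos hα hq).le
    rw [setIntegral_congr_fun measurableSet_Ioc (g := fun s =>
      powDensity α x s * (t - s) ^ (q - 1)) fun s hs => Real.norm_of_nonneg (mul_nonneg
        (powDensity_nonneg hα x s) (Real.rpow_nonneg (sub_nonneg.2 hs.2) _)),
      integral_powDensity_mul hα hq hx]
    split_ifs with hxt
    · have h0 : 0 ≤ t - x := sub_nonneg.2 hxt.le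
      rw [Real.norm_of_nonneg (by positivity)]
      refine mul_le_mul_of_nonneg_right (Real.rpow_le_rpow h0 ?_ (by linarith)) hc
      exact (sub_le_self t hx).trans (le_abs_self t)
    · rw [norm_zero]; positivity
  refine Integrable.mono' (integrable_const (|t| ^ (α + q - 1) * (α * beta α q))) ?_
    (hρ.mono hbound)
  exact hm.norm.aestronglyMeasurable.integral_prod_right'

theorem integrableOn_powPotentialDensity_mul {α q t : ℝ} (hα : 0 < α) (hq : 0 < q)
    (hαq : 1 ≤ α + q) (ρ : Measure ℝ) [IsProbabilityMeasure ρ] (hρ : ∀ᵐ x ∂ρ, 0 ≤ x) :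
    IntegrableOn (fun s => powPotentialDensity α ρ s * (t - s) ^ (q - 1)) (Set.Ioc 0 t) := by
  have h := (integrable_prod_powDensity_mul (t := t) hα hq hαq ρ hρ).integral_prod_right
  simp only [integral_mul_const] at h
  exact h

/-- Two values of `q` matter: `q = 1` recovers `powPotential` as the primitive of its density, and
`q = 1 - α` kills the exponent of `t - x`, leaving a multiple of the mass of `(-∞, t)`. -/
theorem integral_powPotentialDensity_mul {α q t : ℝ} (hα : 0 < α) (hq : 0 < q)
    (hαq : 1 ≤ α + q) (ρ : Measure ℝ) [IsProbabilityMeasure ρ] (hρ : ∀ᵐ x ∂ρ, 0 ≤ x) :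
    ∫ s in Set.Ioc 0 t, powPotentialDensity α ρ s * (t - s) ^ (q - 1) =
      ∫ x, if x < t then (t - x) ^ (α + q - 1) * (α * beta α q) else 0 ∂ρ := by
  have h := integral_integral_swap (f := fun x s => powDensity α x s * (t - s) ^ (q - 1))
    (integrable_prod_powDensity_mul (t := t) hα hq hαq ρ hρ)
  simp only [integral_mul_const] at h
  unfold powPotentialDensity
  rw [← h]
  exact integral_congr_ae (hρ.mono fun x hx => integral_powDensity_mul hα hq hx)

/-- `F` is, up to a constant, `Γ(1 + α)` times the Riemann-Liouville integral of order `α` of a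
function `q` of locally bounded variation on `[0, ∞)`; stated through the density `w` of `F` and the
left limits `l` of `q`. -/
structure IsFractionalPrimitive (α : ℝ) (F q w l : ℝ → ℝ) : Prop where
  measurable : Measurable q
  countable : {t | ¬ ContinuousAt q t}.Countable
  tendsto_left : ∀ t, 0 < t → Tendsto q (𝓝[<] t) (𝓝 (l t))
  intervalIntegrable : ∀ t, 0 < t → IntervalIntegrable w volume 0 t
  eq_integral : ∀ t, 0 ≤ t → F t = F 0 + ∫ s in (0 : ℝ)..t, w s
  intervalIntegrable_mul : α < 1 → ∀ t, 0 < t →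
    IntervalIntegrable (fun s => w s * (t - s) ^ ((1 - α) - 1)) volume 0 t
  riemannLiouville_eq : α < 1 → ∀ t, 0 < t →
    riemannLiouville (1 - α) w t = Real.Gamma (1 + α) * l t
  ae_eq : α = 1 → w =ᵐ[volume] q

namespace IsFractionalPrimitive

variable {α : ℝ} {F G q r w v l m : ℝ → ℝ}

theorem const (α c : ℝ) : IsFractionalPrimitive α (fun _ => c) 0 0 0 where
  measurable := measurable_const
  countable := Set.countable_empty.mono fun t ht => ht continuousAt_const
  tendsto_left _ _ := tendsto_const_nhds
  intervalIntegrable _ _ := intervalIntegrable_const (c := (0 : ℝ))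
  eq_integral _ _ := by simp
  intervalIntegrable_mul _ _ _ := by simp only [Pi.zero_apply, zero_mul]; simp
  riemannLiouville_eq _ _ _ := by simp [riemannLiouville]
  ae_eq _ := ae_eq_rfl

/-- Linear combinations are formed before continuity enters: jumps of `q` and `r` may cancel, and
later only the combination has to be continuous at `t`. -/
theorem add (hF : IsFractionalPrimitive α F q w l) (hG : IsFractionalPrimitive α G r v m) :
    IsFractionalPrimitive α (F + G) (q + r) (w + v) (l + m) where
  measurable := hF.measurable.add hG.measurable
  countable := (hF.countable.union hG.countable).mono fun t ht => by
    by_contra h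
    simp only [Set.mem_union, Set.mem_ofPred_eq, not_or, not_not] at h
    exact ht (h.1.add h.2)
  tendsto_left t ht := (hF.tendsto_left t ht).add (hG.tendsto_left t ht)
  intervalIntegrable t ht := (hF.intervalIntegrable t ht).add (hG.intervalIntegrable t ht)
  eq_integral t ht := by
    have h : ∫ s in (0 : ℝ)..t, (w + v) s = (∫ s in (0 : ℝ)..t, w s) + ∫ s in (0 : ℝ)..t, v s := by
      rcases ht.eq_or_lt with rfl | ht
      · simp
      · exact intervalIntegral.integral_add (hF.intervalIntegrable t ht)
          (hG.intervalIntegrable t ht)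
    rw [h, Pi.add_apply, Pi.add_apply, hF.eq_integral t ht, hG.eq_integral t ht]
    ring
  intervalIntegrable_mul hα t ht := by
    simpa only [Pi.add_apply, add_mul] using
      (hF.intervalIntegrable_mul hα t ht).add (hG.intervalIntegrable_mul hα t ht)
  riemannLiouville_eq hα t ht := by
    rw [Pi.add_apply, mul_add, ← hF.riemannLiouville_eq hα t ht, ← hG.riemannLiouville_eq hα t ht]
    simp only [riemannLiouville, Pi.add_apply, add_mul]
    rw [intervalIntegral.integral_add (hF.intervalIntegrable_mul hα t ht)
      (hG.intervalIntegrable_mul hα t ht), mul_add]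
  ae_eq hα := (hF.ae_eq hα).add (hG.ae_eq hα)

theorem const_mul (c : ℝ) (hF : IsFractionalPrimitive α F q w l) :
    IsFractionalPrimitive α (fun t => c * F t) (fun t => c * q t) (fun t => c * w t)
      (fun t => c * l t) where
  measurable := hF.measurable.const_mul c
  countable := hF.countable.mono fun t ht h => ht (continuousAt_const.mul h)
  tendsto_left t ht := (hF.tendsto_left t ht).const_mul c
  intervalIntegrable t ht := (hF.intervalIntegrable t ht).const_mul c
  eq_integral t ht := by
    rw [intervalIntegral.integral_const_mul, hF.eq_integral t ht, mul_add]
  intervalIntegrable_mul hα t ht := by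
    simpa only [mul_assoc] using (hF.intervalIntegrable_mul hα t ht).const_mul c
  riemannLiouville_eq hα t ht := by
    rw [mul_left_comm, ← hF.riemannLiouville_eq hα t ht]
    simp only [riemannLiouville, mul_assoc, intervalIntegral.integral_const_mul]
    ring
  ae_eq hα := (hF.ae_eq hα).mono fun t ht => by simp only [ht]

theorem congr (hF : IsFractionalPrimitive α F q w l) (hG : ∀ t, 0 ≤ t → G t = F t) :
    IsFractionalPrimitive α G q w l :=
  { hF with
    eq_integral := fun t ht => by rw [hG t ht, hG 0 le_rfl, hF.eq_integral t ht] }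

theorem absolutelyContinuousOnInterval (hF : IsFractionalPrimitive α F q w l) {t : ℝ}
    (ht : 0 < t) : AbsolutelyContinuousOnInterval F 0 t := by
  have h := (hF.intervalIntegrable t ht).absolutelyContinuousOnInterval_intervalIntegral
    (c := 0) (by simp)
  have hF' : ∀ s ∈ Set.uIcc 0 t, F s = F 0 + ∫ x in (0 : ℝ)..s, w x := fun s hs => by
    rw [Set.uIcc_of_le ht.le] at hs
    exact hF.eq_integral s hs.1
  rw [absolutelyContinuousOnInterval_iff] at h ⊢
  intro ε hε
  obtain ⟨δ, hδ, H⟩ := h ε hε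
  refine ⟨δ, hδ, fun E hE hE' => ?_⟩
  convert! H E hE hE' using 2 with i hi
  have := hE.1 i hi
  rw [hF' _ this.1, hF' _ this.2, dist_add_left]

theorem ae_deriv_eq (hF : IsFractionalPrimitive α F q w l) {t : ℝ} (ht : 0 < t) :
    ∀ᵐ s, s ∈ Set.Ioo 0 t → deriv F s = w s := by
  filter_upwards [(hF.intervalIntegrable t ht).ae_hasDerivAt_integral] with s hs hst
  rw [Set.uIcc_of_le ht.le] at hs
  have h := (hs ⟨hst.1.le, hst.2.le⟩ 0 ⟨le_rfl, ht.le⟩).const_add (F 0)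
  refine (h.congr_of_eventuallyEq ?_).deriv
  filter_upwards [lt_mem_nhds hst.1] with x hx using hF.eq_integral x hx.le

theorem hasCaputoDerivAt (hF : IsFractionalPrimitive α F q w l) (hα : α ≤ 1) {t : ℝ} (ht : 0 < t)
    (hq : ContinuousAt q t) : HasCaputoDerivAt α F (Real.Gamma (1 + α) * q t) t := by
  rcases hα.lt_or_eq with hα | hα
  · have hl : l t = q t :=
      tendsto_nhds_unique (hF.tendsto_left t ht) (hq.tendsto.mono_left nhdsWithin_le_nhds)
    have hae : ∀ᵐ s, s ∈ Set.uIoc 0 t →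
        w s * (t - s) ^ ((1 - α) - 1) = deriv F s * (t - s) ^ ((1 - α) - 1) := by
      filter_upwards [hF.ae_deriv_eq ht, Measure.ae_ne volume t] with s hs hst hs'
      rw [Set.uIoc_of_le ht.le] at hs'
      rw [hs ⟨hs'.1, hs'.2.lt_of_ne hst⟩]
    refine Or.inl ⟨hα, ?_, ?_⟩
    · exact (hF.intervalIntegrable_mul hα t ht).congr_ae
        ((ae_restrict_iff' measurableSet_uIoc).2 hae)
    · rw [← hl, ← hF.riemannLiouville_eq hα t ht, riemannLiouville, riemannLiouville,
        intervalIntegral.integral_congr_ae hae]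
  · refine Or.inr ⟨hα, ?_⟩
    rw [hα, one_add_one_eq_two, Real.Gamma_two, one_mul]
    have hwq := hF.ae_eq hα
    have h1 : IntervalIntegrable q volume 0 t :=
      (hF.intervalIntegrable t ht).congr_ae (ae_restrict_of_ae hwq)
    have h2 := (intervalIntegral.integral_hasDerivAt_right h1
      hF.measurable.stronglyMeasurable.stronglyMeasurableAtFilter hq).const_add (F 0)
    refine h2.congr_of_eventuallyEq ?_
    filter_upwards [lt_mem_nhds ht] with x hx
    rw [hF.eq_integral x hx.le, intervalIntegral.integral_congr_ae (hwq.mono fun s hs _ => hs)]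

end IsFractionalPrimitive

theorem powPotential_zero {α : ℝ} (hα : 0 < α) {ρ : Measure ℝ} (hρ : ∀ᵐ x ∂ρ, 0 ≤ x) :
    powPotential α ρ 0 = 0 := by
  refine integral_eq_zero_of_ae (hρ.mono fun x hx => ?_)
  simp [max_eq_right (neg_nonpos.2 hx), Real.zero_rpow hα.ne']

/-- After Fubini, the constant for `α < 1` comes from `α B(α, 1 - α) / Γ(1 - α) = α Γ(α) = Γ(1 +
α)`. For `α = 1` the density is itself the mass of `(-∞, t)`, which differs from the distribution
function only at its countably many jumps. -/
theorem isFractionalPrimitive_powPotential {α : ℝ} (hα : 0 < α) (ρ : Measure ℝ)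
    [IsProbabilityMeasure ρ] (hρ : ∀ᵐ x ∂ρ, 0 ≤ x) :
    IsFractionalPrimitive α (powPotential α ρ) (fun t => ρ.real (Set.Iic t))
      (powPotentialDensity α ρ) (fun t => ρ.real (Set.Iio t)) := by
  have hmono : Monotone fun t => ρ.real (Set.Iic t) := fun s t h =>
    measureReal_mono (Set.Iic_subset_Iic.2 h)
  have hleft : ∀ t, Tendsto (fun t => ρ.real (Set.Iic t)) (𝓝[<] t) (𝓝 (ρ.real (Set.Iio t))) := by
    intro t
    have h := tendsto_measure_of_tendsto_indicator_of_isFiniteMeasure (𝓝[<] t) (A := Set.Iio t) ρ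
      (As := fun s => Set.Iic s) (fun s => measurableSet_Iic) fun x => ?_
    · exact (ENNReal.tendsto_toReal (measure_ne_top _ _)).comp h
    · rcases lt_or_ge x t with hx | hx
      · filter_upwards [mem_nhdsWithin_of_mem_nhds (lt_mem_nhds hx)] with s hs
        exact iff_of_true (le_of_lt hs) hx
      · filter_upwards [self_mem_nhdsWithin] with s hs
        exact iff_of_false (fun h : x ≤ s => absurd hs (not_lt.2 (hx.trans h))) (not_lt.2 hx)
  have hone : ∀ s t : ℝ, (t - s) ^ ((1 : ℝ) - 1) = 1 := fun s t => by simp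
  have hcount := hmono.countable_not_continuousAt
  refine ⟨hmono.measurable, hcount, fun t _ => hleft t, fun t ht => ?_, fun t ht => ?_,
    fun h1 t ht => ?_, fun h1 t ht => ?_, fun h1 => ?_⟩
  · have := integrableOn_powPotentialDensity_mul (t := t) hα one_pos (by linarith) ρ hρ
    simp only [hone, mul_one] at this
    rwa [intervalIntegrable_iff_integrableOn_Ioc_of_le ht.le]
  · have := integral_powPotentialDensity_mul (t := t) hα one_pos (by linarith) ρ hρ
    simp only [hone, mul_one] at this
    rw [powPotential_zero hα hρ, zero_add, intervalIntegral.integral_of_le ht, this]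
    refine integral_congr_ae (ae_of_all _ fun x => ?_)
    have hb : α * beta α 1 = 1 := by
      have := Real.Gamma_pos_of_pos hα
      rw [beta, Real.Gamma_one, mul_one, Real.Gamma_add_one hα.ne']
      field_simp
    simp only [hb, mul_one, add_sub_cancel_right]
    split_ifs with h
    · rw [max_eq_left (by linarith)]
    · rw [max_eq_right (by linarith), Real.zero_rpow hα.ne']
  · rw [intervalIntegrable_iff_integrableOn_Ioc_of_le ht.le]
    exact integrableOn_powPotentialDensity_mul hα (by linarith) (by linarith) ρ hρ
  · have hΓ := (Real.Gamma_pos_of_pos (sub_pos.2 h1)).ne'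
    rw [riemannLiouville, intervalIntegral.integral_of_le ht.le,
      integral_powPotentialDensity_mul hα (by linarith) (by linarith) ρ hρ]
    have : ∀ x, (if x < t then (t - x) ^ (α + (1 - α) - 1) * (α * beta α (1 - α)) else 0) =
        (Set.Iio t).indicator (fun _ => α * beta α (1 - α)) x := fun x => by
      simp [Set.indicator_apply]
    simp only [this]
    rw [integral_indicator measurableSet_Iio, setIntegral_const, smul_eq_mul, beta,
      add_sub_cancel, Real.Gamma_one, add_comm 1 α, Real.Gamma_add_one hα.ne']
    field_simp
  · subst h1
    filter_upwards [hcount.ae_notMem volume] with t ht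
    simp only [not_not] at ht
    rw [← tendsto_nhds_unique (hleft t) (ht.tendsto.mono_left nhdsWithin_le_nhds)]
    have : ∀ x, powDensity 1 x t = (Set.Iio t).indicator (fun _ => 1) x := fun x => by
      simp [powDensity, Set.indicator_apply]
    simp only [powPotentialDensity, this]
    rw [integral_indicator measurableSet_Iio, setIntegral_const, smul_eq_mul, mul_one]

end Fractional

/-! ### Counting visits and the last-visit decomposition. -/

section Visits

variable {X : Type*}

open Classical in
/-- The number of visits to `A` of the orbit of `x` at the times `1, …, k`. -/
noncomputable def visits (T : X → X) (A : Set X) (k : ℕ) (x : X) : ℕ :=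
  Nat.count (fun j => T^[j + 1] x ∈ A) k

@[simp]
theorem visits_zero (T : X → X) (A : Set X) (x : X) : visits T A 0 x = 0 := by
  rw [visits, Nat.count_zero]

theorem returnTime_succ_le_iff (T : X → X) (A : Set X) (d k : ℕ) (x : X) :
    returnTime T A (d + 1) x ≤ k ↔ ∃ j < k, returnTime T A d x ≤ j ∧ T^[j + 1] x ∈ A := by
  rw [returnTime]
  set s := {m : ℕ∞ | ∃ n : ℕ, m = n ∧ returnTime T A d x < n ∧ T^[n] x ∈ A}
  constructor
  · intro h
    have hs : s.Nonempty := by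
      by_contra hs
      rw [Set.not_nonempty_iff_eq_empty.1 hs, sInf_empty] at h
      exact absurd h (by simp)
    -- `ℕ∞` is well ordered, so a nonempty infimum is attained.
    obtain ⟨n, hn, hlt, hA⟩ : sInf s ∈ s := csInf_mem hs
    rw [hn, Nat.cast_le] at h
    obtain ⟨j, rfl⟩ : ∃ j, n = j + 1 :=
      Nat.exists_eq_succ_of_ne_zero fun h0 => by simp [h0] at hlt
    refine ⟨j, h, ?_, hA⟩
    push_cast at hlt
    exact Order.le_of_lt_add_one hlt
  · rintro ⟨j, hj, hle, hA⟩
    have hmem : ((j + 1 : ℕ) : ℕ∞) ∈ s :=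
      ⟨j + 1, rfl, hle.trans_lt (Nat.cast_lt.2 j.lt_succ_self), hA⟩
    exact (sInf_le hmem).trans (Nat.cast_le.2 hj)

theorem succ_le_visits_iff (T : X → X) (A : Set X) (d k : ℕ) (x : X) :
    d + 1 ≤ visits T A k x ↔ ∃ j < k, d ≤ visits T A j x ∧ T^[j + 1] x ∈ A := by
  classical
  induction k with
  | zero => simp
  | succ k ih =>
    have h : visits T A (k + 1) x = visits T A k x + if T^[k + 1] x ∈ A then 1 else 0 := by
      rw [visits, Nat.count_succ]
      congr 1
    have h2 : (∃ j < k + 1, d ≤ visits T A j x ∧ T^[j + 1] x ∈ A) ↔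
        (∃ j < k, d ≤ visits T A j x ∧ T^[j + 1] x ∈ A) ∨
          d ≤ visits T A k x ∧ T^[k + 1] x ∈ A := Nat.exists_lt_succ_right
    rw [h2, ← ih, h]
    split_ifs with hA
    · simp only [hA, and_true]; omega
    · simp only [hA, and_false, or_false, add_zero]

/-- Replaces the recursive infima by counts, which behave well under one application of `T`
(`visits_succ`). -/
theorem returnTime_le_iff (T : X → X) (A : Set X) (d k : ℕ) (x : X) :
    returnTime T A d x ≤ k ↔ d ≤ visits T A k x := by
  induction d generalizing k with
  | zero => simp [returnTime]
  | succ d ih => simp_rw [returnTime_succ_le_iff, succ_le_visits_iff, ih]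

theorem visits_succ (T : X → X) (A : Set X) (k : ℕ) (x : X) :
    visits T A (k + 1) x = visits T A k (T x) + A.indicator 1 (T x) := by
  classical
  rw [visits, Nat.count_succ', Set.indicator_apply]
  congr 1

theorem measurableSet_le_visits [MeasurableSpace X] {T : X → X} (hT : Measurable T) {A : Set X}
    (hA : MeasurableSet A) (d k : ℕ) : MeasurableSet {x | d ≤ visits T A k x} := by
  induction k generalizing d with
  | zero => simp
  | succ k ih =>
    have : {x | d ≤ visits T A (k + 1) x} =
        T ⁻¹' ({x | d ≤ visits T A k x} ∪ {x | d ≤ visits T A k x + 1} ∩ A) := by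
      ext x
      by_cases h : T x ∈ A <;> (simp [visits_succ, h]; try omega)
    rw [this]
    refine hT ((ih d).union (MeasurableSet.inter ?_ hA))
    -- Truncated subtraction is right here: for `d = 0` both conditions hold everywhere.
    simpa using ih (d - 1)

/-- The indicator function of `{r_A⁽ᵈ⁾ ≤ k}`. -/
noncomputable def visitInd (T : X → X) (A : Set X) (d k : ℕ) : X → ℝ :=
  {x | d ≤ visits T A k x}.indicator 1

theorem measurable_visitInd [MeasurableSpace X] {T : X → X} (hT : Measurable T) {A : Set X}
    (hA : MeasurableSet A) (d k : ℕ) : Measurable (visitInd T A d k) :=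
  measurable_one.indicator (measurableSet_le_visits hT hA d k)

theorem visitInd_nonneg (T : X → X) (A : Set X) (d k : ℕ) (x : X) : 0 ≤ visitInd T A d k x :=
  Set.indicator_nonneg (fun _ _ => zero_le_one) x

theorem visitInd_le_one (T : X → X) (A : Set X) (d k : ℕ) (x : X) : visitInd T A d k x ≤ 1 :=
  Set.indicator_le_self' (fun _ _ => zero_le_one) x

/-- Decomposition of the event `{r_A⁽ᵈ⁺¹⁾ ≤ m}` according to the `(d + 1)`-st last visit to `A`
before time `m`. -/
theorem visitInd_eq_sum (T : X → X) (A : Set X) (d m : ℕ) (x : X) :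
    visitInd T A (d + 1) m x = ∑ k ∈ Finset.range m, A.indicator (fun y =>
      visitInd T A d (m - 1 - k) y - visitInd T A (d + 1) (m - 1 - k) y) (T^[k + 1] x) := by
  classical
  induction m generalizing x with
  | zero => simp [visitInd]
  | succ m ih =>
    rw [Finset.sum_range_succ']
    -- All terms but `k = 0` form the decomposition for `T x` with horizon `m`. The remaining term
    -- is the case where time `1` is the relevant visit.
    have : ∀ k, m + 1 - 1 - (k + 1) = m - 1 - k := fun k => by omega
    simp only [this, Function.iterate_succ_apply T (_ + 1)]
    rw [← ih (T x)]
    by_cases h : T x ∈ A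
    · simp only [zero_add, Function.iterate_one, Nat.add_sub_cancel, Nat.sub_zero,
        Set.indicator_of_mem h, visitInd, Set.indicator_apply, Set.mem_ofPred_eq, visits_succ,
        Pi.one_apply]
      split_ifs <;> first | omega | norm_num
    · simp [visitInd, Set.indicator_apply, visits_succ, h]

end Visits

/-! ### Duality with the transfer operator and stopped sums. -/

section Transfer

variable {X : Type*} [MeasurableSpace X] {T : X → X} {μ : Measure X}

theorem transferOp_nonneg {f : X → ℝ} (hf : 0 ≤ᵐ[μ] f) : 0 ≤ᵐ[μ] transferOp T μ f := by
  have h : (μ.withDensity fun y => ENNReal.ofReal (-f y)) = 0 := by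
    rw [withDensity_congr_ae (g := 0) (hf.mono fun x hx => by simpa using hx), withDensity_zero]
  filter_upwards [Measure.rnDeriv_zero μ] with x hx
  simp only [transferOp, h, Measure.map_zero]
  rw [hx]
  simp

theorem integrable_iterate_transferOp {f : X → ℝ} (hf : Integrable f μ) (k : ℕ) :
    Integrable ((transferOp T μ)^[k] f) μ := by
  induction k with
  | zero => exact hf
  | succ k ih => rw [Function.iterate_succ_apply']; exact integrable_transferOp ih

theorem iterate_transferOp_nonneg {f : X → ℝ} (hf : 0 ≤ᵐ[μ] f) (k : ℕ) :
    0 ≤ᵐ[μ] (transferOp T μ)^[k] f := by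
  induction k with
  | zero => exact hf
  | succ k ih => rw [Function.iterate_succ_apply']; exact transferOp_nonneg ih

theorem integral_iterate_transferOp_mul [SigmaFinite μ] (hT : MeasurePreserving T μ μ) {f : X → ℝ}
    (hf : Integrable f μ) {g : X → ℝ} (hg : Measurable g) {C : ℝ} (hC : ∀ x, |g x| ≤ C) (k : ℕ) :
    ∫ x, f x * g (T^[k] x) ∂μ = ∫ x, (transferOp T μ)^[k] f x * g x ∂μ := by
  induction k generalizing f with
  | zero => rfl
  | succ k ih =>
    rw [Function.iterate_succ_apply, ← ih (integrable_transferOp hf)]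
    exact integral_transferOp_mul hT hf (hg.comp (hT.measurable.iterate k)) fun x => hC _

theorem monotone_transferSum {f : X → ℝ} (hf : 0 ≤ᵐ[μ] f) :
    ∀ᵐ x ∂μ, Monotone fun n => transferSum T μ f n x := by
  filter_upwards [ae_all_iff.2 fun k => iterate_transferOp_nonneg (T := T) hf k] with x hx
  refine monotone_nat_of_le_succ fun n => ?_
  rw [transferSum, transferSum, Finset.sum_range_succ]
  exact le_add_of_nonneg_right (hx n)

/-- `∑_{k < j} T̂^k f` with the random number `j = (m - r_A⁽ᵈ⁾)_+ + 1` of terms. -/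
noncomputable def stoppedSum (T : X → X) (μ : Measure X) (f : X → ℝ) (A : Set X) (d m : ℕ)
    (x : X) : ℝ :=
  transferSum T μ f (((m : ℕ∞) - returnTime T A d x).toNat + 1) x

theorem stoppedSum_eq (f : X → ℝ) (A : Set X) (d m : ℕ) (x : X) :
    stoppedSum T μ f A d m x = f x + ∑ k ∈ Finset.range m,
      (transferOp T μ)^[k + 1] f x * visitInd T A d (m - 1 - k) x := by
  rw [stoppedSum, transferSum, Finset.sum_range_succ', add_comm, Function.iterate_zero, id]
  congr 1
  set j := ((m : ℕ∞) - returnTime T A d x).toNat with hj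
  -- `r⁽ᵈ⁾ ≤ m - 1 - k` says `k < m - r⁽ᵈ⁾`, so the indicators cut the sum off at `j`. If `r⁽ᵈ⁾ =
  -- ⊤`, then `j = 0` and only `f x` survives.
  have hlt : ∀ k < m, (d ≤ visits T A (m - 1 - k) x ↔ k < j) := fun k hk => by
    rw [← returnTime_le_iff, hj]
    cases returnTime T A d x using ENat.recTopCoe with
    | top => simp
    | coe n =>
      rw [Nat.cast_le, ← ENat.natCast_sub, ENat.toNat_natCast]
      omega
  have hjm : j ≤ m := by
    have : ((m : ℕ∞) - returnTime T A d x) ≤ m := tsub_le_self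
    exact ENat.toNat_le_of_le_natCast this
  rw [← Finset.sum_subset (Finset.range_subset_range.2 hjm)]
  · refine Finset.sum_congr rfl fun k hk => ?_
    have hk := Finset.mem_range.1 hk
    simp [visitInd, (hlt k (hk.trans_le hjm)).2 hk]
  · intro k hk hk'
    have hk := Finset.mem_range.1 hk
    simp [visitInd, (hlt k hk).not.2 (Finset.mem_range.not.1 hk')]

theorem integrable_stoppedSum (hT : Measurable T) {f : X → ℝ} (hf : Integrable f μ) {A : Set X}
    (hA : MeasurableSet A) (d m : ℕ) : Integrable (stoppedSum T μ f A d m) μ := by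
  simp only [funext (stoppedSum_eq (T := T) (μ := μ) f A d m)]
  refine hf.add (integrable_finsetSum _ fun k _ => ?_)
  refine (integrable_iterate_transferOp hf (k + 1)).mul_bdd (c := 1)
    (measurable_visitInd hT hA _ _).aestronglyMeasurable (ae_of_all _ fun x => ?_)
  rw [Real.norm_of_nonneg (visitInd_nonneg ..)]
  exact visitInd_le_one ..

/-- Integrate `visitInd_eq_sum` against `f` and apply duality term by term. The extra summand `f` in
each stopped sum, absent from the decomposition, cancels in the difference. -/
theorem integral_mul_visitInd [SigmaFinite μ] (hT : MeasurePreserving T μ μ) {f : X → ℝ}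
    (hf : Integrable f μ) {A : Set X} (hA : MeasurableSet A) (d m : ℕ) :
    ∫ x, f x * visitInd T A (d + 1) m x ∂μ =
      ∫ x in A, stoppedSum T μ f A d m x ∂μ - ∫ x in A, stoppedSum T μ f A (d + 1) m x ∂μ := by
  classical
  set g : ℕ → X → ℝ := fun k => A.indicator fun y =>
    visitInd T A d (m - 1 - k) y - visitInd T A (d + 1) (m - 1 - k) y with hgdef
  have hg : ∀ k, Measurable (g k) := fun k =>
    ((measurable_visitInd hT.measurable hA _ _).sub
      (measurable_visitInd hT.measurable hA _ _)).indicator hA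
  have hg1 : ∀ k x, |g k x| ≤ 1 := fun k x => by
    have h1 := visitInd_nonneg T A d (m - 1 - k) x
    have h2 := visitInd_nonneg T A (d + 1) (m - 1 - k) x
    have h3 := visitInd_le_one T A d (m - 1 - k) x
    have h4 := visitInd_le_one T A (d + 1) (m - 1 - k) x
    simp only [hgdef, Set.indicator_apply]
    split_ifs <;> rw [abs_le] <;> constructor <;> linarith
  have hi : ∀ k, Integrable (fun x => f x * g k (T^[k + 1] x)) μ := fun k =>
    hf.mul_bdd (c := 1) ((hg k).comp (hT.measurable.iterate _)).aestronglyMeasurable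
      (ae_of_all _ fun x => hg1 k _)
  have hi' : ∀ k, Integrable (fun x => (transferOp T μ)^[k + 1] f x * g k x) μ := fun k =>
    (integrable_iterate_transferOp hf (k + 1)).mul_bdd (c := 1) (hg k).aestronglyMeasurable
      (ae_of_all _ fun x => hg1 k _)
  simp only [visitInd_eq_sum T A d m, Finset.mul_sum]
  rw [integral_finsetSum _ fun k _ => hi k]
  simp only [fun k => integral_iterate_transferOp_mul hT hf (hg k) (hg1 k) (k + 1)]
  rw [← integral_finsetSum _ fun k _ => hi' k,
    ← integral_sub (integrable_stoppedSum hT.measurable hf hA d m).integrableOn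
      (integrable_stoppedSum hT.measurable hf hA (d + 1) m).integrableOn,
    ← integral_indicator hA]
  refine integral_congr_ae (ae_of_all _ fun x => ?_)
  simp only [stoppedSum_eq, hgdef, Set.indicator_apply]
  split_ifs
  · rw [add_sub_add_left_eq_sub, ← Finset.sum_sub_distrib]
    exact Finset.sum_congr rfl fun k _ => mul_sub _ _ _
  · simp

end Transfer

/-! ### Grid approximation and asymptotic inverses. -/

section Scaling

theorem abs_rpow_sub_rpow_le {α x y : ℝ} (hα0 : 0 < α) (hα1 : α ≤ 1) (hx : 0 ≤ x) (hy : 0 ≤ y) :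
    |x ^ α - y ^ α| ≤ |x - y| ^ α := by
  wlog h : y ≤ x generalizing x y
  · rw [abs_sub_comm, abs_sub_comm x]
    exact this hy hx (le_of_not_ge h)
  have h1 := Real.rpow_le_rpow hy h hα0.le
  rw [abs_of_nonneg (sub_nonneg.2 h1), abs_of_nonneg (sub_nonneg.2 h), sub_le_iff_le_add]
  have := Real.rpow_add_le_add_rpow (sub_nonneg.2 h) hy hα0.le hα1
  rwa [sub_add_cancel] at this

/-- Monotone functions that are close to a multiple of `s ^ α` on a grid are uniformly close. -/
theorem abs_sub_rpow_le_of_grid {α c h ε γ : ℝ} (hα0 : 0 < α) (hα1 : α ≤ 1) (hc : 0 ≤ c)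
    (hh : 0 < h) (hε : 0 ≤ ε) (hγ : 0 < γ) {u : ℕ → ℝ} (hu : Monotone u) (hu0 : 0 ≤ u 0) {K : ℕ}
    (hgrid : ∀ i < K, |u ⌊(i + 1 : ℕ) * h / γ⌋₊ - c * ((i + 1 : ℕ) * h) ^ α| ≤ ε) {j : ℕ}
    (hj : j * γ < K * h) : |u j - c * (j * γ) ^ α| ≤ ε + c * h ^ α := by
  have hx : 0 ≤ j * γ := by positivity
  set i := ⌊j * γ / h⌋₊ with hi
  have h1 : i * h ≤ j * γ := (le_div_iff₀ hh).1 (Nat.floor_le (by positivity))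
  have h2 : j * γ < (i + 1 : ℕ) * h := by
    rw [← div_lt_iff₀ hh]; push_cast; exact Nat.lt_floor_add_one _
  have hiK : i < K := by
    rw [hi, Nat.floor_lt (by positivity)]; exact (div_lt_iff₀ hh).2 hj
  have hpow : ∀ y, 0 ≤ y → |j * γ - y| ≤ h → |c * (j * γ) ^ α - c * y ^ α| ≤ c * h ^ α := by
    intro y hy hyh
    rw [← mul_sub, abs_mul, abs_of_nonneg hc]
    exact mul_le_mul_of_nonneg_left ((abs_rpow_sub_rpow_le hα0 hα1 hx hy).trans
      (Real.rpow_le_rpow (abs_nonneg _) hyh hα0.le)) hc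
  have hup : u j ≤ u ⌊(i + 1 : ℕ) * h / γ⌋₊ :=
    hu (Nat.le_floor ((le_div_iff₀ hγ).2 h2.le))
  have hup2 := abs_le.1 (hgrid i hiK)
  have hup3 := abs_le.1 (hpow ((i + 1 : ℕ) * h) (by positivity) (by
    push_cast at h2 ⊢
    rw [abs_le]; constructor <;> linarith))
  have hlow : c * (i * h) ^ α - ε ≤ u j := by
    -- The grid starts at `h`, so below its first point the lower bound comes from `0 ≤ u 0`.
    rcases Nat.eq_zero_or_pos i with h0 | h0
    · rw [h0, Nat.cast_zero, zero_mul, Real.zero_rpow hα0.ne', mul_zero]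
      have := hu (Nat.zero_le j)
      linarith
    · obtain ⟨i', hi'⟩ := Nat.exists_eq_succ_of_ne_zero h0.ne'
      have h3 := abs_le.1 (hgrid i' (by omega))
      rw [← Nat.succ_eq_add_one, ← hi'] at h3
      have : u ⌊i * h / γ⌋₊ ≤ u j :=
        hu (Nat.floor_le_of_le ((div_le_iff₀ hγ).2 h1))
      linarith
  have hlow3 := abs_le.1 (hpow (i * h) (by positivity) (by
    push_cast at h2
    rw [abs_le]; constructor <;> linarith))
  rw [abs_le]
  constructor <;> linarith

theorem IsAsymptoticInverse.tendsto_comp_atTop {a b : ℝ → ℝ} (hb : IsAsymptoticInverse a b) :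
    Tendsto (fun s => a (b s)) atTop atTop :=
  hb.right.symm.tendsto_atTop tendsto_id

/-- While `b s ≤ M`, the value `a ⌊b s⌋₊` ranges over a finite set, whereas `a (b s) ∼ s` is
unbounded. -/
theorem IsAsymptoticInverse.tendsto_atTop {a : ℕ → ℝ} {b : ℝ → ℝ}
    (hb : IsAsymptoticInverse (seqFun a) b) : Tendsto b atTop atTop := by
  refine Filter.tendsto_atTop.2 fun M => ?_
  filter_upwards [hb.tendsto_comp_atTop.eventually_gt_atTop
    (∑ i ∈ Finset.range (⌊M⌋₊ + 1), |a i|)] with s hs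
  by_contra! h
  refine absurd hs (not_lt.2 ((le_abs_self _).trans ?_))
  exact Finset.single_le_sum (f := fun i => |a i|) (fun i _ => abs_nonneg _)
    (Finset.mem_range.2 (Nat.lt_succ_of_le (Nat.floor_le_floor h.le)))

theorem IsAsymptoticInverse.tendsto_div {a : ℕ → ℝ} {b : ℝ → ℝ} {α : ℝ}
    (ha : IsRegularlyVarying (seqFun a) α) (hb : IsAsymptoticInverse (seqFun a) b) {s : ℝ}
    (hs : 0 < s) : Tendsto (fun x => a ⌊s * b x⌋₊ / x) atTop (𝓝 (s ^ α)) := by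
  have h1 := (ha.tendsto s hs).comp hb.tendsto_atTop
  have h2 : Tendsto (fun x => seqFun a (b x) / x) atTop (𝓝 1) := by
    refine (Asymptotics.isEquivalent_iff_tendsto_one ?_).1 hb.right
    exact (eventually_ne_atTop 0)
  have h3 := h1.mul h2
  rw [mul_one] at h3
  refine h3.congr' ?_
  filter_upwards [hb.tendsto_comp_atTop.eventually_ne_atTop 0] with x hx
  simp only [Function.comp_apply]
  rw [div_mul_div_cancel₀ hx, seqFun, mul_comm]

end Scaling

/-! ### Uniform asymptotics of transfer sums on a uniform set. -/

section Uniform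

variable {X : Type*} [MeasurableSpace X] {T : X → X} {μ : Measure X}

/-- On a uniform set, `μ(E_n) ∑_{k < s / γ_n} T̂^k f` is uniformly close to `s ^ α ∫ f dμ`. -/
theorem eventually_ae_abs_transferSum_sub_le {Y : Set X} {a : ℕ → ℝ} {f : X → ℝ} {α : ℝ}
    (hunif : Tendsto (fun n => eLpNorm (fun x => transferSum T μ f n x / a n - ∫ y, f y ∂μ) ∞
        (μ.restrict Y)) atTop (𝓝 0))
    (ha : IsRegularlyVarying (seqFun a) α) {b : ℝ → ℝ} (hb : IsAsymptoticInverse (seqFun a) b)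
    {s ε : ℝ} (hs : 0 < s) (hε : 0 < ε) :
    ∀ᶠ x in atTop, ∀ᵐ y ∂μ.restrict Y,
      |transferSum T μ f ⌊s * b x⌋₊ y / x - (∫ y, f y ∂μ) * s ^ α| ≤ ε := by
  set c := ∫ y, f y ∂μ
  have hsα : 0 < s ^ α := Real.rpow_pos_of_pos hs _
  have hlim := IsAsymptoticInverse.tendsto_div ha hb hs
  set δ := ε / (2 * (s ^ α + 1)) with hδ
  have hδ0 : 0 < δ := by positivity
  have hk : Tendsto (fun x => ⌊s * b x⌋₊) atTop atTop :=
    tendsto_nat_floor_atTop.comp (hb.tendsto_atTop.const_mul_atTop hs)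
  have h1 := hk.eventually (hunif.eventually (ge_mem_nhds (ENNReal.ofReal_pos.2 hδ0)))
  have h2 := hlim.eventually (lt_mem_nhds hsα)
  have h3 := hlim.eventually (gt_mem_nhds (lt_add_one (s ^ α)))
  have h4 := (tendsto_order.1 ((hlim.sub_const (s ^ α)).const_mul c).abs).2 (ε / 2) (by
    rw [sub_self, mul_zero, abs_zero]; positivity)
  filter_upwards [h1, h2, h3, h4, eventually_gt_atTop 0] with x h1 h2 h3 h4 hx
  rw [eLpNorm_exponent_top] at h1
  filter_upwards [ae_le_eLpNormEssSup (μ := μ.restrict Y) (f := fun x_1 =>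
    transferSum T μ f ⌊s * b x⌋₊ x_1 / a ⌊s * b x⌋₊ - c)] with y hy
  have hy := hy.trans h1
  rw [← ofReal_norm, ENNReal.ofReal_le_ofReal_iff hδ0.le, Real.norm_eq_abs] at hy
  set k := ⌊s * b x⌋₊
  have hak : a k ≠ 0 := fun h => by rw [h, zero_div] at h2; exact lt_irrefl _ h2
  -- The first error is the uniform-set error times a bounded ratio, at most `δ (s ^ α + 1) = ε /
  -- 2`; the second is pure regular variation of `a`.
  have e : transferSum T μ f k y / x - c * s ^ α =
      (transferSum T μ f k y / a k - c) * (a k / x) + c * (a k / x - s ^ α) := by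
    field_simp
    ring
  rw [e]
  refine (abs_add_le _ _).trans ?_
  rw [abs_mul, abs_of_pos h2]
  have : |transferSum T μ f k y / a k - c| * (a k / x) ≤ δ * (s ^ α + 1) :=
    mul_le_mul hy h3.le h2.le hδ0.le
  have : δ * (s ^ α + 1) = ε / 2 := by rw [hδ]; field_simp
  linarith

/-- Monotonicity in `j` reduces all `j` to finitely many grid times. This gives uniformity in `j`,
which is needed because `j` will be the random number of terms of a stopped sum. -/
theorem eventually_ae_forall_abs_transferSum_sub_le {Y : Set X} {a : ℕ → ℝ} {f : X → ℝ} {α : ℝ}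
    (hα0 : 0 < α) (hα1 : α ≤ 1) (hf : 0 ≤ᵐ[μ] f)
    (hunif : Tendsto (fun n => eLpNorm (fun x => transferSum T μ f n x / a n - ∫ y, f y ∂μ) ∞
        (μ.restrict Y)) atTop (𝓝 0)) (hc : 0 < ∫ y, f y ∂μ)
    (ha : IsRegularlyVarying (seqFun a) α) {b : ℝ → ℝ} (hb : IsAsymptoticInverse (seqFun a) b)
    (τ : ℝ) {ε : ℝ} (hε : 0 < ε) :
    ∀ᶠ x in atTop, ∀ᵐ y ∂μ.restrict Y, ∀ j : ℕ, j * (1 / b x) ≤ τ →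
      |transferSum T μ f j y / x - (∫ y, f y ∂μ) * (j * (1 / b x)) ^ α| ≤ ε := by
  set c := ∫ y, f y ∂μ
  obtain ⟨h, hh, hhε⟩ : ∃ h : ℝ, 0 < h ∧ c * h ^ α = ε / 2 :=
    ⟨(ε / 2 / c) ^ α⁻¹, by positivity, by
      rw [Real.rpow_inv_rpow (by positivity) hα0.ne']; field_simp⟩
  obtain ⟨K, hK⟩ := exists_nat_gt (τ / h)
  rw [div_lt_iff₀ hh] at hK
  have hgrid : ∀ᶠ x in atTop, ∀ i ∈ Finset.range K, ∀ᵐ y ∂μ.restrict Y,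
      |transferSum T μ f ⌊((i + 1 : ℕ) * h) * b x⌋₊ y / x - c * ((i + 1 : ℕ) * h) ^ α| ≤ ε / 2 :=
    (Finset.eventually_all _).2 fun i _ =>
      eventually_ae_abs_transferSum_sub_le hunif ha hb (by positivity) (by positivity)
  filter_upwards [hgrid, hb.tendsto_atTop.eventually_gt_atTop 0, eventually_gt_atTop 0]
    with x hx hbx hx0
  filter_upwards [(ae_ball_iff (Finset.range K).countable_toSet).2 hx,
    ae_restrict_of_ae (monotone_transferSum (T := T) hf)] with y hy hmono j hj
  have := abs_sub_rpow_le_of_grid (u := fun j => transferSum T μ f j y / x) hα0 hα1 hc.le hh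
    (half_pos hε).le (one_div_pos.2 hbx) (fun i j hij => div_le_div_of_nonneg_right (hmono hij)
      hx0.le) (by simp [transferSum]) (K := K) (fun i hi => ?_) (hj.trans_lt hK)
  · rw [hhε, add_halves] at this
    exact this
  · rw [div_div_eq_mul_div, div_one]
    exact hy i (Finset.mem_range.2 hi)

end Uniform

/-! ### Limits of the stopped sums under the return law. -/

section Limit

/-- The function `x ↦ (t - x)_+ ^ α` on `[0, ∞]`. -/
noncomputable def truncPow (α t : ℝ) (x : ℝ≥0∞) : ℝ := (ENNReal.ofReal t - x).toReal ^ α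

theorem continuous_truncPow {α : ℝ} (hα : 0 < α) (t : ℝ) : Continuous (truncPow α t) := by
  refine Continuous.rpow_const ?_ fun _ => Or.inr hα.le
  refine continuous_iff_continuousAt.2 fun x => ?_
  exact (ENNReal.tendsto_toReal (ne_top_of_le_ne_top ENNReal.ofReal_ne_top tsub_le_self)).comp
    (ENNReal.continuous_sub_left ENNReal.ofReal_ne_top).continuousAt

theorem truncPow_nonneg (α t : ℝ) (x : ℝ≥0∞) : 0 ≤ truncPow α t x :=
  Real.rpow_nonneg ENNReal.toReal_nonneg _

theorem truncPow_le {α : ℝ} (hα : 0 < α) {t : ℝ} (ht : 0 ≤ t) (x : ℝ≥0∞) :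
    truncPow α t x ≤ t ^ α := by
  refine Real.rpow_le_rpow ENNReal.toReal_nonneg ?_ hα.le
  rw [← ENNReal.toReal_ofReal ht]
  exact ENNReal.toReal_mono (by simp) (by simp [ENNReal.toReal_ofReal ht])

theorem toReal_ofReal_sub {t : ℝ} {x : ℝ≥0∞} (hx : x ≠ ∞) :
    (ENNReal.ofReal t - x).toReal = max (t - x.toReal) 0 := by
  conv_lhs => rw [← ENNReal.ofReal_toReal hx, ← ENNReal.ofReal_sub t ENNReal.toReal_nonneg]
  rw [ENNReal.toReal_ofReal']

/-- The floor and the extra term each shift the rescaled number of terms by at most `γ`, in opposite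
directions. When the return comes after the horizon, one term is left and the error is exactly `γ`.
-/
theorem abs_mul_sub_toReal_le {t γ : ℝ} (ht : 0 ≤ t) (hγ : 0 < γ) (r : ℕ∞) :
    |(((⌊t / γ⌋₊ : ℕ∞) - r).toNat + 1 : ℕ) * γ -
      (ENNReal.ofReal t - ENNReal.ofReal γ * (r : ℝ≥0∞)).toReal| ≤ γ := by
  have h1 : (⌊t / γ⌋₊ : ℝ) * γ ≤ t := (le_div_iff₀ hγ).1 (Nat.floor_le (by positivity))
  have h2 : t < (⌊t / γ⌋₊ + 1 : ℝ) * γ := (div_lt_iff₀ hγ).1 (Nat.lt_floor_add_one _)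
  set m := ⌊t / γ⌋₊
  cases r using ENat.recTopCoe with
  | top => simp [hγ, abs_of_pos]
  | coe n =>
    have e : ENNReal.ofReal γ * ((n : ℕ∞) : ℝ≥0∞) = ENNReal.ofReal (γ * n) := by
      rw [ENNReal.ofReal_mul hγ.le]; simp
    rw [e, toReal_ofReal_sub ENNReal.ofReal_ne_top, ENNReal.toReal_ofReal (by positivity),
      ← ENat.natCast_sub, ENat.toNat_natCast]
    rcases le_or_gt n m with hn | hn
    · have hn' : (n : ℝ) ≤ m := Nat.cast_le.2 hn
      rw [max_eq_left (by nlinarith), Nat.cast_add, Nat.cast_sub hn, Nat.cast_one, abs_le]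
      constructor <;> nlinarith
    · have hn' : (m + 1 : ℝ) ≤ n := by exact_mod_cast hn
      rw [max_eq_right (by nlinarith), Nat.sub_eq_zero_of_le hn.le]
      simp [abs_of_pos hγ]

variable {X : Type*} [MeasurableSpace X] {T : X → X} {μ : Measure X}

theorem measurable_returnTime (hT : Measurable T) {A : Set X} (hA : MeasurableSet A) (d : ℕ) :
    Measurable (returnTime T A d) := by
  have h : ∀ k : ℕ, MeasurableSet {x | returnTime T A d x ≤ k} := fun k => by
    simp only [returnTime_le_iff]
    exact measurableSet_le_visits hT hA d k
  refine ENat.measurable_iff.2 fun n => ?_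
  cases n with
  | zero =>
    convert! h 0 using 1
    ext x
    simp
  | succ n =>
    convert! (h (n + 1)).diff (h n) using 1
    ext x
    simp only [Set.mem_preimage, Set.mem_singleton_iff, Set.mem_sdiff, Set.mem_ofPred_eq, not_le]
    cases returnTime T A d x using ENat.recTopCoe with
    | top => simpa using (ENat.natCast_ne_top (n + 1)).symm
    | coe r => norm_cast; omega

theorem measurable_scaled_returnTime (hT : Measurable T) {A : Set X} (hA : MeasurableSet A)
    (d : ℕ) (γ : ℝ) :
    Measurable fun x => ENNReal.ofReal γ * (returnTime T A d x : ℝ≥0∞) :=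
  (measurable_from_top.comp (measurable_returnTime hT hA d)).const_mul _

theorem setIntegral_eq_integral_cond {A : Set X} (h0 : μ A ≠ 0) (h1 : μ A ≠ ⊤) (G : X → ℝ) :
    ∫ y in A, G y ∂μ = ∫ y, G y / (1 / μ.real A) ∂μ[|A] := by
  have : μ.real A ≠ 0 := (measureReal_ne_zero_iff h1).2 h0
  rw [integral_div, ProbabilityTheory.cond, integral_smul_measure, ENNReal.toReal_inv, smul_eq_mul,
    ← Measure.real]
  field_simp

theorem abs_setIntegral_stoppedSum_sub_le {f : X → ℝ} {α c γ ε t : ℝ} (hα0 : 0 < α) (hα1 : α ≤ 1)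
    (hc : 0 ≤ c) (hγ : 0 < γ) (hγ1 : γ ≤ 1) (ht : 0 ≤ t) (hT : Measurable T)
    (hf : Integrable f μ) {A : Set X} (hA : MeasurableSet A) (h0 : μ A ≠ 0) (h1 : μ A ≠ ⊤)
    (hbound : ∀ᵐ y ∂μ.restrict A, ∀ j : ℕ, j * γ ≤ t + 1 →
      |transferSum T μ f j y / (1 / μ.real A) - c * (j * γ) ^ α| ≤ ε) (d : ℕ) :
    |∫ y in A, stoppedSum T μ f A d ⌊t / γ⌋₊ y ∂μ -
      c * ∫ y, truncPow α t (ENNReal.ofReal γ * (returnTime T A d y : ℝ≥0∞)) ∂μ[|A]| ≤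
        ε + c * γ ^ α := by
  have := cond_isProbabilityMeasure_of_finite h0 h1
  rw [setIntegral_eq_integral_cond h0 h1, ← integral_const_mul, ← integral_sub]
  · rw [← Real.norm_eq_abs]
    suffices h : ∀ᵐ y ∂μ[|A], ‖stoppedSum T μ f A d ⌊t / γ⌋₊ y / (1 / μ.real A) -
        c * truncPow α t (ENNReal.ofReal γ * (returnTime T A d y : ℝ≥0∞))‖ ≤ ε + c * γ ^ α from
      (norm_integral_le_of_norm_le_const h).trans_eq (by rw [probReal_univ, mul_one])
    refine Measure.ae_smul_measure (hbound.mono fun y hy => ?_) _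
    have hr := abs_mul_sub_toReal_le ht hγ (returnTime T A d y)
    rw [Real.norm_eq_abs, stoppedSum]
    set j := ((⌊t / γ⌋₊ : ℕ∞) - returnTime T A d y).toNat + 1 with hj
    -- The extra term can push `j γ` beyond `t`, but by at most `γ ≤ 1`; hence the range `t + 1` in
    -- `hbound`.
    have hjt : j * γ ≤ t + 1 := by
      have h2 : j ≤ ⌊t / γ⌋₊ + 1 :=
        Nat.succ_le_succ (ENat.toNat_le_of_le_natCast tsub_le_self)
      have h3 : (⌊t / γ⌋₊ : ℝ) * γ ≤ t := (le_div_iff₀ hγ).1 (Nat.floor_le (by positivity))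
      have h4 : (j : ℝ) ≤ ⌊t / γ⌋₊ + 1 := by exact_mod_cast h2
      nlinarith
    refine (abs_sub_le _ (c * (j * γ) ^ α) _).trans (add_le_add (hy j hjt) ?_)
    rw [← mul_sub, abs_mul, abs_of_nonneg hc]
    refine mul_le_mul_of_nonneg_left ?_ hc
    exact (abs_rpow_sub_rpow_le hα0 hα1 (by positivity) ENNReal.toReal_nonneg).trans
      (Real.rpow_le_rpow (abs_nonneg _) hr hα0.le)
  · exact ((integrable_stoppedSum hT hf hA d _).restrict.smul_measure
      (ENNReal.inv_ne_top.2 h0)).div_const _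
  · refine (Integrable.of_bound (C := t ^ α) ((continuous_truncPow hα0 t).measurable.comp
      (measurable_scaled_returnTime hT hA d γ)).aestronglyMeasurable
      (ae_of_all _ fun y => ?_)).const_mul c
    simp only [Function.comp_apply]
    rw [Real.norm_of_nonneg (truncPow_nonneg ..)]
    exact truncPow_le hα0 ht _

/-- The laws of `0, Ψ⁽¹⁾, Ψ⁽²⁾, …`, as measures on the real line. -/
noncomputable def coordLaw {Ω : Type*} [MeasurableSpace Ω] (P : Measure Ω) (Ψ : Ω → ℕ → ℝ≥0∞) :
    ℕ → Measure ℝ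
  | 0 => Measure.dirac 0
  | d + 1 => P.map fun ω => (Ψ ω d).toReal

/-- `truncPow α t` is bounded and continuous on all of `[0, ∞]`, vanishing at `∞`, so convergence in
law of a single coordinate suffices. For `d = 0` both sides equal `t ^ α`. -/
theorem tendsto_integral_truncPow {α t : ℝ} (hα : 0 < α) (ht : 0 ≤ t) {b : ℝ → ℝ} {E : ℕ → Set X}
    {ν : ℕ → Measure X} [∀ n, IsProbabilityMeasure (ν n)]
    {Ω : Type*} [MeasurableSpace Ω] {P : Measure Ω} [IsProbabilityMeasure P] {Ψ : Ω → ℕ → ℝ≥0∞}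
    (h : TendstoInDistribution (fun n => scaledReturns T μ b (E n)) atTop Ψ ν P)
    (hΨ : ∀ᵐ ω ∂P, Ψ ω ∈ locallyFinitePaths) (d : ℕ) :
    Tendsto (fun n => ∫ y, truncPow α t (ENNReal.ofReal (scaling b (μ.real (E n))) *
      (returnTime T (E n) d y : ℝ≥0∞)) ∂ν n) atTop (𝓝 (powPotential α (coordLaw P Ψ d) t)) := by
  cases d with
  | zero =>
    simp [returnTime, coordLaw, powPotential, truncPow, ENNReal.toReal_ofReal ht, max_eq_left ht]
  | succ d =>
    have h1 := h.continuous_comp (continuous_apply d)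
    have h2 := (ProbabilityMeasure.tendsto_iff_forall_integral_tendsto.1 h1.tendsto)
      (BoundedContinuousFunction.ofNormedAddCommGroup (truncPow α t) (continuous_truncPow hα t)
        (t ^ α) fun x => by
          rw [Real.norm_of_nonneg (truncPow_nonneg ..)]; exact truncPow_le hα ht x)
    simp only [BoundedContinuousFunction.coe_ofNormedAddCommGroup, ProbabilityMeasure.coe_mk] at h2
    have hm := (continuous_truncPow hα t).measurable.stronglyMeasurable
    rw [integral_map h1.aemeasurable_limit hm.aestronglyMeasurable] at h2
    simp only [fun n => integral_map (h1.forall_aemeasurable n) hm.aestronglyMeasurable] at h2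
    convert! h2 using 2
    rw [powPotential, coordLaw, integral_map (φ := fun ω => (Ψ ω d).toReal)
      h1.aemeasurable_limit.ennreal_toReal]
    · refine integral_congr_ae (hΨ.mono fun ω hω => ?_)
      simp only [Function.comp_apply, truncPow, toReal_ofReal_sub (hω.1 d)]
    · exact Measurable.aestronglyMeasurable (by fun_prop)

theorem tendsto_setIntegral_stoppedSum {f : X → ℝ} {α : ℝ} (hα0 : 0 < α) (hα1 : α ≤ 1)
    (hT : Measurable T) (hf : Integrable f μ) (hf0 : 0 ≤ᵐ[μ] f) (hc : 0 < ∫ y, f y ∂μ)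
    {Y : Set X} {a : ℕ → ℝ}
    (hunif : Tendsto (fun n => eLpNorm (fun x => transferSum T μ f n x / a n - ∫ y, f y ∂μ) ∞
        (μ.restrict Y)) atTop (𝓝 0))
    (ha : IsRegularlyVarying (seqFun a) α) {b : ℝ → ℝ} (hb : IsAsymptoticInverse (seqFun a) b)
    {E : ℕ → Set X} (hE : ∀ n, MeasurableSet (E n)) (hEY : ∀ n, E n ≤ᵐ[μ] Y)
    (hEpos : ∀ n, μ (E n) ≠ 0) (hEfin : ∀ n, μ (E n) ≠ ⊤)
    (hrare : Tendsto (fun n => 1 / μ.real (E n)) atTop atTop) {t : ℝ} (ht : 0 ≤ t) (d : ℕ) {L : ℝ}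
    (hL : Tendsto (fun n => ∫ y, truncPow α t (ENNReal.ofReal (scaling b (μ.real (E n))) *
      (returnTime T (E n) d y : ℝ≥0∞)) ∂μ[|E n]) atTop (𝓝 L)) :
    Tendsto (fun n => ∫ y in E n,
      stoppedSum T μ f (E n) d ⌊t / scaling b (μ.real (E n))⌋₊ y ∂μ) atTop
      (𝓝 ((∫ y, f y ∂μ) * L)) := by
  set c := ∫ y, f y ∂μ
  have hbt := hb.tendsto_atTop.comp hrare
  have hγ : Tendsto (fun n => scaling b (μ.real (E n))) atTop (𝓝 0) := by
    simp only [scaling, one_div (b _)]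
    exact hbt.inv_tendsto_atTop
  have hγα : Tendsto (fun n => c * scaling b (μ.real (E n)) ^ α) atTop (𝓝 0) := by
    have := (hγ.rpow_const (Or.inr hα0.le)).const_mul c
    rwa [Real.zero_rpow hα0.ne', mul_zero] at this
  refine tendsto_of_tendsto_of_dist (hL.const_mul c) ?_
  refine tendsto_order.2 ⟨fun ε hε => Eventually.of_forall fun n => hε.trans_le dist_nonneg,
    fun ε hε => ?_⟩
  filter_upwards [hrare.eventually (eventually_ae_forall_abs_transferSum_sub_le hα0 hα1 hf0 hunif hc
    ha hb (t + 1) (half_pos hε)), hbt.eventually_gt_atTop 0, hγ.eventually (ge_mem_nhds one_pos),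
    hγα.eventually (gt_mem_nhds (half_pos hε))] with n h1 h2 h3 h4
  rw [dist_comm, Real.dist_eq]
  refine (abs_setIntegral_stoppedSum_sub_le hα0 hα1 hc.le (one_div_pos.2 h2) h3 ht hT hf (hE n)
    (hEpos n) (hEfin n) (ε := ε / 2) ?_ d).trans_lt 
    ((add_lt_add_right h4 _).trans_eq (add_halves ε))
  exact ae_mono (Measure.restrict_mono_ae (hEY n)) h1

end Limit

/-! ### Counting probabilities through the laws of the coordinates. -/

section CoordLaw

variable {Ω : Type*} [MeasurableSpace Ω] {P : Measure Ω} {Ψ : Ω → ℕ → ℝ≥0∞}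

theorem aemeasurable_toReal_apply (hm : AEMeasurable Ψ P) (d : ℕ) :
    AEMeasurable (fun ω => (Ψ ω d).toReal) P :=
  ((measurable_pi_apply d).comp_aemeasurable hm).ennreal_toReal

theorem isProbabilityMeasure_coordLaw [IsProbabilityMeasure P] (hm : AEMeasurable Ψ P) (d : ℕ) :
    IsProbabilityMeasure (coordLaw P Ψ d) := by
  cases d with
  | zero => rw [coordLaw]; infer_instance
  | succ d =>
    exact Measure.isProbabilityMeasure_map (aemeasurable_toReal_apply hm d)

theorem ae_coordLaw_nonneg (hm : AEMeasurable Ψ P) (d : ℕ) : ∀ᵐ x ∂coordLaw P Ψ d, 0 ≤ x := by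
  cases d with
  | zero => simp [coordLaw]
  | succ d =>
    rw [coordLaw, ae_map_iff (aemeasurable_toReal_apply hm d)
      measurableSet_Ici]
    exact ae_of_all _ fun ω => ENNReal.toReal_nonneg

theorem coordLaw_succ_real_Iic (hm : AEMeasurable Ψ P) (d : ℕ) (t : ℝ) :
    (coordLaw P Ψ (d + 1)).real (Set.Iic t) = P.real {ω | (Ψ ω d).toReal ≤ t} := by
  rw [coordLaw, map_measureReal_apply_of_aemeasurable
    (aemeasurable_toReal_apply hm d) measurableSet_Iic]
  rfl

/-- A path is monotone and tends to `∞`, so the indices of its points in `[0, t]` form a finite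
initial segment. -/
theorem exists_toPointMeasure_Icc_eq {φ : ℕ → ℝ≥0∞} (hφ : φ ∈ locallyFinitePaths) {t : ℝ}
    (ht : 0 ≤ t) : ∃ k : ℕ, toPointMeasure φ (Set.Icc 0 t.toNNReal) = k ∧
      ∀ i, i < k ↔ (φ i).toReal ≤ t := by
  classical
  have hex : ∃ i, ¬ (φ i).toReal ≤ t := by
    obtain ⟨i, hi⟩ := (hφ.2.2.eventually (lt_mem_nhds (ENNReal.ofReal_lt_top (r := t)))).exists
    exact ⟨i, not_le.2 ((ENNReal.ofReal_lt_iff_lt_toReal ht (hφ.1 i)).1 hi)⟩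
  have hlt : ∀ i, i < Nat.find hex ↔ (φ i).toReal ≤ t := fun i => by
    refine ⟨fun h => not_not.1 (Nat.find_min hex h), fun h => ?_⟩
    by_contra h'
    replace h' := not_lt.1 h'
    have hle : (φ (Nat.find hex)).toReal ≤ (φ i).toReal :=
      ENNReal.toReal_mono (hφ.1 i) (hφ.2.1 h')
    exact Nat.find_spec hex (hle.trans h)
  refine ⟨Nat.find hex, ?_, hlt⟩
  have hdirac : ∀ i, Measure.dirac (φ i).toNNReal (Set.Icc 0 t.toNNReal) =
      if i ∈ Finset.range (Nat.find hex) then (1 : ℝ≥0∞) else 0 := fun i => by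
    rw [Measure.dirac_apply' _ measurableSet_Icc, Set.indicator_apply]
    have : (φ i).toNNReal ∈ Set.Icc 0 t.toNNReal ↔ i ∈ Finset.range (Nat.find hex) := by
      rw [Finset.mem_range, hlt, Set.mem_Icc, Real.le_toNNReal_iff_coe_le ht]
      exact and_iff_right zero_le
    simp only [this, Pi.one_apply]
  rw [toPointMeasure, if_pos hφ, Measure.sum_apply _ measurableSet_Icc]
  simp_rw [hdirac]
  rw [tsum_eq_sum (s := Finset.range (Nat.find hex)) fun i hi => if_neg hi,
    Finset.sum_congr rfl fun i hi => if_pos hi]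
  simp

theorem countProb_eq_sub [IsProbabilityMeasure P] (hm : AEMeasurable Ψ P)
    (hΨ : ∀ᵐ ω ∂P, Ψ ω ∈ locallyFinitePaths)
    {N : Ω → Measure ℝ≥0} (hN : ∀ ω, N ω = toPointMeasure (Ψ ω)) (d : ℕ) {t : ℝ} (ht : 0 ≤ t) :
    countProb P N d t =
      (coordLaw P Ψ d).real (Set.Iic t) - (coordLaw P Ψ (d + 1)).real (Set.Iic t) := by
  have hnull : ∀ d, NullMeasurableSet {ω | (Ψ ω d).toReal ≤ t} P := fun d =>
    (aemeasurable_toReal_apply hm d).nullMeasurableSet_preimage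
      measurableSet_Iic
  rw [countProb, if_neg (by omega), Int.toNat_natCast]
  set S := {ω | N ω (Set.Icc 0 t.toNNReal) = (d : ℝ≥0∞)} with hS
  have hd : AEDisjoint P S {ω | (Ψ ω d).toReal ≤ t} := by
    refine measure_mono_null (t := {ω | ¬ Ψ ω ∈ locallyFinitePaths}) ?_ (ae_iff.1 hΨ)
    rintro ω ⟨h1, h2⟩ h
    obtain ⟨k, hk, hlt⟩ := exists_toPointMeasure_Icc_eq h ht
    rw [hS, Set.mem_ofPred_eq, hN, hk, Nat.cast_inj] at h1
    exact absurd ((hlt d).2 h2) (by omega)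
  -- Additivity needs null measurability of only one of the two sets, so none has to be proved for
  -- `S`.
  have hadd : P.real (S ∪ {ω | (Ψ ω d).toReal ≤ t}) =
      P.real S + P.real {ω | (Ψ ω d).toReal ≤ t} := measureReal_union₀ (hnull d) hd
  rw [coordLaw_succ_real_Iic hm, eq_sub_iff_add_eq, ← hadd]
  cases d with
  | zero =>
    have : (coordLaw P Ψ 0).real (Set.Iic t) = 1 := by simp [coordLaw, measureReal_def, ht]
    rw [this, ← probReal_univ (μ := P)]
    refine measureReal_congr (hΨ.mono fun ω h => ?_)
    obtain ⟨k, hk, hlt⟩ := exists_toPointMeasure_Icc_eq h ht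
    refine propext (iff_of_true ?_ trivial)
    rcases Nat.eq_zero_or_pos k with h0 | h0
    · left; rw [hS, Set.mem_ofPred_eq, hN, hk, h0]
    · right; exact (hlt 0).1 h0
  | succ d =>
    rw [coordLaw_succ_real_Iic hm]
    refine measureReal_congr (hΨ.mono fun ω h => ?_)
    obtain ⟨k, hk, hlt⟩ := exists_toPointMeasure_Icc_eq h ht
    have h1 : ω ∈ S ↔ k = d + 1 := by rw [hS, Set.mem_ofPred_eq, hN, hk, Nat.cast_inj]
    refine propext ?_
    change ω ∈ S ∨ (Ψ ω (d + 1)).toReal ≤ t ↔ (Ψ ω d).toReal ≤ t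
    rw [h1, ← hlt, ← hlt]
    omega

end CoordLaw

/-! ### From hitting probabilities to the relation between the two limits. -/

section Hitting

variable {X : Type*} [MeasurableSpace X] {T : X → X} {μ : Measure X}

theorem ofReal_mul_le_ofReal_iff {γ t : ℝ} (hγ : 0 < γ) (ht : 0 ≤ t) (r : ℕ∞) :
    ENNReal.ofReal γ * (r : ℝ≥0∞) ≤ ENNReal.ofReal t ↔ r ≤ (⌊t / γ⌋₊ : ℕ) := by
  cases r using ENat.recTopCoe with
  | top => simp [ENNReal.mul_top, hγ]
  | coe n =>
    have e : ENNReal.ofReal γ * ((n : ℕ∞) : ℝ≥0∞) = ENNReal.ofReal (γ * n) := by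
      rw [ENNReal.ofReal_mul hγ.le]; simp
    rw [e, ENNReal.ofReal_le_ofReal_iff ht, Nat.cast_le, Nat.le_floor_iff (by positivity),
      le_div_iff₀ hγ, mul_comm]

/-- Normalizing `f dμ` gives a probability measure absolutely continuous with respect to `μ`, to
which the hitting limit applies. -/
theorem integral_mul_visitInd_eq_measureReal {f : X → ℝ} (hf : Integrable f μ) (hf0 : 0 ≤ᵐ[μ] f)
    (hc : 0 < ∫ y, f y ∂μ) (hT : Measurable T) {A : Set X} (hA : MeasurableSet A) (d m : ℕ) :
    ∫ x, f x * visitInd T A d m x ∂μ = (∫ y, f y ∂μ) *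
      (μ.withDensity fun x => ENNReal.ofReal (f x / ∫ y, f y ∂μ)).real
        {x | d ≤ visits T A m x} := by
  set c := ∫ y, f y ∂μ
  have hS := measurableSet_le_visits hT hA d m
  rw [measureReal_def, withDensity_apply _ hS, ← ofReal_integral_eq_lintegral_ofReal
    (hf.div_const c).restrict (ae_restrict_of_ae (hf0.mono fun x hx => div_nonneg hx hc.le)),
    ENNReal.toReal_ofReal (setIntegral_nonneg_ae hS (hf0.mono fun x hx _ => div_nonneg hx hc.le)),
    integral_div, mul_div_cancel₀ _ hc.ne', ← integral_indicator hS]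
  refine integral_congr_ae (ae_of_all _ fun x => ?_)
  by_cases h : x ∈ {x | d ≤ visits T A m x}
  · simp only [visitInd, Set.indicator_of_mem h, Pi.one_apply, mul_one]
  · simp only [visitInd, Set.indicator_of_notMem h, mul_zero]

theorem isProbabilityMeasure_withDensity_div {f : X → ℝ} (hf : Integrable f μ) (hf0 : 0 ≤ᵐ[μ] f)
    (hc : 0 < ∫ y, f y ∂μ) :
    IsProbabilityMeasure (μ.withDensity fun x => ENNReal.ofReal (f x / ∫ y, f y ∂μ)) := by
  refine ⟨?_⟩
  rw [withDensity_apply _ MeasurableSet.univ, Measure.restrict_univ,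
    ← ofReal_integral_eq_lintegral_ofReal (hf.div_const _)
      (hf0.mono fun x hx => div_nonneg hx hc.le), integral_div, div_self hc.ne', ENNReal.ofReal_one]

theorem tendsto_measureReal_scaledReturns_le {b : ℝ → ℝ} {E : ℕ → Set X} {ν : Measure X}
    [IsProbabilityMeasure ν] {Ω : Type*} [MeasurableSpace Ω] {P : Measure Ω}
    [IsProbabilityMeasure P] {Ψ : Ω → ℕ → ℝ≥0∞}
    (h : TendstoInDistribution (fun n => scaledReturns T μ b (E n)) atTop Ψ (fun _ => ν) P)
    (hΨ : ∀ᵐ ω ∂P, Ψ ω ∈ locallyFinitePaths) {t : ℝ} (ht : 0 ≤ t) (d : ℕ)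
    (hatom : P {ω | (Ψ ω d).toReal = t} = 0) :
    Tendsto (fun n => ν.real {x | scaledReturns T μ b (E n) x d ≤ ENNReal.ofReal t}) atTop
      (𝓝 ((coordLaw P Ψ (d + 1)).real (Set.Iic t))) := by
  have h1 := h.continuous_comp (continuous_apply d)
  have h2 := ProbabilityMeasure.tendsto_measure_of_null_frontier_of_tendsto' h1.tendsto
    (E := Set.Iic (ENNReal.ofReal t)) (by
      refine measure_mono_null (frontier_Iic_subset _) ?_
      rw [ProbabilityMeasure.coe_mk, Measure.map_apply_of_aemeasurable h1.aemeasurable_limit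
        (measurableSet_singleton _)]
      refine measure_mono_null (fun ω hω => ?_) hatom
      have hω : Ψ ω d = ENNReal.ofReal t := hω
      rw [Set.mem_ofPred_eq, hω, ENNReal.toReal_ofReal ht])
  simp only [ProbabilityMeasure.coe_mk] at h2
  rw [Measure.map_apply_of_aemeasurable h1.aemeasurable_limit measurableSet_Iic] at h2
  simp only [fun n => Measure.map_apply_of_aemeasurable (h1.forall_aemeasurable n)
    (measurableSet_Iic (a := ENNReal.ofReal t))] at h2
  have h3 := (ENNReal.tendsto_toReal (measure_ne_top _ _)).comp h2
  rw [coordLaw_succ_real_Iic h.aemeasurable_limit]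
  convert! h3 using 2
  refine measureReal_congr (hΨ.mono fun ω hω => propext ?_)
  exact (ENNReal.le_ofReal_iff_toReal_le (hω.1 d) ht).symm

theorem continuousWithinAt_powPotential {α : ℝ} (hα : 0 < α) (ρ : Measure ℝ)
    [IsProbabilityMeasure ρ] (hρ : ∀ᵐ x ∂ρ, 0 ≤ x) {t : ℝ} (ht : 0 ≤ t) :
    ContinuousWithinAt (powPotential α ρ) (Set.Ioi t) t := by
  have h := ((isFractionalPrimitive_powPotential hα ρ hρ).absolutelyContinuousOnInterval
    (t := t + 1) (by linarith)).continuousOn t (by rw [Set.uIcc_of_le] <;> grind)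
  refine h.mono_of_mem_nhdsWithin ?_
  rw [Set.uIcc_of_le (by linarith)]
  filter_upwards [Ioo_mem_nhdsGT (lt_add_one t)] with s hs using ⟨ht.trans hs.1.le, hs.2.le⟩

/-- The relation between the laws of the hitting and of the return process. -/
theorem coordLaw_real_Iic_eq_sub [SigmaFinite μ] (hT : MeasurePreserving T μ μ) {α : ℝ}
    (hα0 : 0 < α) (hα1 : α ≤ 1) {Y : Set X} {a : ℕ → ℝ} (hY : IsUniformSet T μ Y a)
    (ha : IsRegularlyVarying (seqFun a) α) {b : ℝ → ℝ} (hb : IsAsymptoticInverse (seqFun a) b)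
    {E : ℕ → Set X} (hE : ∀ n, MeasurableSet (E n)) (hEY : ∀ n, E n ≤ᵐ[μ] Y)
    (hEpos : ∀ n, μ (E n) ≠ 0) (hEfin : ∀ n, μ (E n) ≠ ⊤)
    (hErare : Tendsto (fun n => μ (E n)) atTop (𝓝 0))
    {Ω : Type*} [MeasurableSpace Ω] {P : Measure Ω} [IsProbabilityMeasure P] {Ψ : Ω → ℕ → ℝ≥0∞}
    {Ω' : Type*} [MeasurableSpace Ω'] {P' : Measure Ω'} [IsProbabilityMeasure P']
    {Ψ' : Ω' → ℕ → ℝ≥0∞}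
    (hhit : TendstoStronglyInLaw μ (fun n => scaledReturns T μ b (E n)) Ψ P)
    (hret : haveI : ∀ n, IsProbabilityMeasure (μ[|E n]) :=
        fun n => cond_isProbabilityMeasure_of_finite (hEpos n) (hEfin n)
      TendstoInDistribution (fun n => scaledReturns T μ b (E n)) atTop Ψ' (fun n => μ[|E n]) P')
    (hΨ : ∀ᵐ ω ∂P, Ψ ω ∈ locallyFinitePaths) (hΨ' : ∀ᵐ ω ∂P', Ψ' ω ∈ locallyFinitePaths)
    (d : ℕ) {t : ℝ} (ht : 0 ≤ t) :
    (coordLaw P Ψ (d + 1)).real (Set.Iic t) =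
      powPotential α (coordLaw P' Ψ' d) t - powPotential α (coordLaw P' Ψ' (d + 1)) t := by
  obtain ⟨-, -, f, hf, hf0, hc, hunif⟩ := hY
  have hcond : ∀ n, IsProbabilityMeasure (μ[|E n]) :=
    fun n => cond_isProbabilityMeasure_of_finite (hEpos n) (hEfin n)
  have hm' := hret.aemeasurable_limit
  have hν := isProbabilityMeasure_withDensity_div hf hf0 hc
  have hlaw := hhit _ (withDensity_absolutelyContinuous μ fun x =>
    ENNReal.ofReal (f x / ∫ y, f y ∂μ))
  have hm := hlaw.aemeasurable_limit
  have hp := isProbabilityMeasure_coordLaw hm (d + 1)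
  have hrare : Tendsto (fun n => 1 / μ.real (E n)) atTop atTop := by
    simp only [one_div]
    refine Tendsto.inv_tendsto_nhdsGT_zero (tendsto_nhdsWithin_iff.2 ⟨?_, ?_⟩)
    · exact (ENNReal.tendsto_toReal ENNReal.zero_ne_top).comp hErare
    · exact Eventually.of_forall fun n => ENNReal.toReal_pos (hEpos n) (hEfin n)
  have key : ∀ t, 0 ≤ t → P {ω | (Ψ ω d).toReal = t} = 0 →
      (coordLaw P Ψ (d + 1)).real (Set.Iic t) =
        powPotential α (coordLaw P' Ψ' d) t - powPotential α (coordLaw P' Ψ' (d + 1)) t := by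
    intro t ht hatom
    have hlim : ∀ e, _ := fun e => tendsto_setIntegral_stoppedSum hα0 hα1 hT.measurable hf hf0 hc
      hunif ha hb hE hEY hEpos hEfin hrare ht e (tendsto_integral_truncPow hα0 ht hret hΨ' e)
    have h1 := (hlim d).sub (hlim (d + 1))
    simp only [← integral_mul_visitInd hT hf (hE _), ← mul_sub] at h1
    have h2 := (tendsto_measureReal_scaledReturns_le hlaw hΨ ht d hatom).const_mul (∫ y, f y ∂μ)
    refine mul_left_cancel₀ hc.ne' (tendsto_nhds_unique (h2.congr' ?_) h1)
    filter_upwards [(hb.tendsto_atTop.comp hrare).eventually_gt_atTop 0] with n hn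
    rw [integral_mul_visitInd_eq_measureReal hf hf0 hc hT.measurable (hE n)]
    simp only [scaledReturns, ofReal_mul_le_ofReal_iff
      (show 0 < scaling b (μ.real (E n)) from one_div_pos.2 hn) ht, returnTime_le_iff]
  have hcont : ∀ e, ContinuousWithinAt (powPotential α (coordLaw P' Ψ' e)) (Set.Ioi t) t := fun e =>
    have := isProbabilityMeasure_coordLaw hm' e
    continuousWithinAt_powPotential hα0 _ (ae_coordLaw_nonneg hm' e) ht
  have hright : Tendsto (fun s => (coordLaw P Ψ (d + 1)).real (Set.Iic s)) (𝓝[>] t)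
      (𝓝 ((coordLaw P Ψ (d + 1)).real (Set.Iic t))) := by
    simp only [← cdf_eq_real]
    exact ((cdf (coordLaw P Ψ (d + 1))).right_continuous t).tendsto.mono_left
      (nhdsWithin_mono _ Set.Ioi_subset_Ici_self)
  have hcount : {s : ℝ | 0 < P {ω | (Ψ ω d).toReal = s}}.Countable :=
    Measure.countable_meas_level_set_pos₀
      (aemeasurable_toReal_apply hm d).nullMeasurable
  -- `key` excludes the countably many atoms of the coordinate. Their complement is dense and both
  -- sides are right-continuous, so the identity extends to every `t`.
  refine tendsto_nhds_unique_of_frequently_eq hright ((hcont d).sub (hcont (d + 1))) ?_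
  refine (nhdsGT_basis t).frequently_iff.2 fun u hu => ?_
  obtain ⟨s, hs, hts⟩ := (hcount.dense_compl ℝ).exists_between hu
  exact ⟨s, hts, key s (ht.trans hts.1.le) (by simpa using hs)⟩

end Hitting

end RareEvents

/-! ### The fractional differential equation. -/

open MeasureTheory ProbabilityTheory Filter Topology RareEvents in
theorem mainTheorem9
    {X : Type*} [MeasurableSpace X] (μ : Measure X) [SigmaFinite μ] (hμ : μ Set.univ = ⊤)
    (T : X → X) (hT : IsCEMPT T μ) (hPDE : IsPointwiseDualErgodic T μ)
    (α : ℝ) (hα0 : 0 < α) (hα1 : α ≤ 1)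
    -- a uniform set `Y` with a regularly varying normalizing sequence `a`
    (Y : Set X) (a : ℕ → ℝ) (hY : IsUniformSet T μ Y a) (ha : IsRegularlyVarying (seqFun a) α)
    (b : ℝ → ℝ) (hb : IsAsymptoticInverse (seqFun a) b)
    -- asymptotically rare events inside `Y`
    (E : ℕ → Set X) (hE : ∀ n, MeasurableSet (E n)) (hEY : ∀ n, E n ≤ᵐ[μ] Y)
    (hEpos : ∀ n, μ (E n) ≠ 0) (hEfin : ∀ n, μ (E n) ≠ ⊤)
    (hErare : Tendsto (fun n => μ (E n)) atTop (𝓝 0))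
    -- the limit `Ψ` of the hitting processes and the limit `Ψ'` of the return processes
    {Ω : Type*} [MeasurableSpace Ω] (P : Measure Ω) [IsProbabilityMeasure P]
    (Ψ : Ω → ℕ → ENNReal)
    {Ω' : Type*} [MeasurableSpace Ω'] (P' : Measure Ω') [IsProbabilityMeasure P']
    (Ψ' : Ω' → ℕ → ENNReal)
    (hhit : TendstoStronglyInLaw μ (fun n => scaledReturns T μ b (E n)) Ψ P)
    (hret : haveI : ∀ n, IsProbabilityMeasure (μ[|E n]) :=
        fun n => cond_isProbabilityMeasure_of_finite (hEpos n) (hEfin n)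
      TendstoInDistribution (fun n => scaledReturns T μ b (E n)) atTop Ψ' (fun n => μ[|E n]) P')
    (hΨ : ∀ᵐ ω ∂P, Ψ ω ∈ locallyFinitePaths) (hΨ' : ∀ᵐ ω ∂P', Ψ' ω ∈ locallyFinitePaths)
    -- the limit hitting point process `N` and the limit return point process `N'`
    (N : Ω → Measure NNReal) (hN : ∀ ω, N ω = toPointMeasure (Ψ ω))
    (N' : Ω' → Measure NNReal) (hN' : ∀ ω, N' ω = toPointMeasure (Ψ' ω)) :
    countProb P N 0 0 = 1 ∧
    ∀ d : ℕ,
      (∀ t, 0 < t → AbsolutelyContinuousOnInterval (countProb P N d) 0 t) ∧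
      {t | 0 < t ∧
        ¬ ContinuousAt (fun s => countProb P' N' (d - 1) s - countProb P' N' d s) t}.Countable ∧
      ∀ t, 0 < t →
        ContinuousAt (fun s => countProb P' N' (d - 1) s - countProb P' N' d s) t →
        HasCaputoDerivAt α (countProb P N d)
          (Real.Gamma (1 + α) * (countProb P' N' (d - 1) t - countProb P' N' d t)) t := by
  have hcond : ∀ n, IsProbabilityMeasure (μ[|E n]) :=
    fun n => cond_isProbabilityMeasure_of_finite (hEpos n) (hEfin n)
  have hm' := hret.aemeasurable_limit
  obtain ⟨-, -, f, hf, hf0, hc, -⟩ := id hY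
  have hν := isProbabilityMeasure_withDensity_div hf hf0 hc
  have hm := (hhit _ (withDensity_absolutelyContinuous μ fun x =>
    ENNReal.ofReal (f x / ∫ y, f y ∂μ))).aemeasurable_limit
  have hrel : ∀ e (t : ℝ), 0 ≤ t → _ := fun e (t : ℝ) ht =>
    coordLaw_real_Iic_eq_sub hT.measurePreserving hα0 hα1 hY ha hb hE hEY hEpos hEfin hErare hhit hret hΨ hΨ' e (t := t) ht
  have hN0 : ∀ e (t : ℝ), 0 ≤ t → _ := fun e (t : ℝ) ht =>
    countProb_eq_sub hm hΨ hN e (t := t) ht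
  have hN1 : ∀ e (t : ℝ), 0 ≤ t → _ := fun e (t : ℝ) ht =>
    countProb_eq_sub hm' hΨ' hN' e (t := t) ht
  have hH : ∀ e, _ := fun e =>
    have := isProbabilityMeasure_coordLaw hm' e
    isFractionalPrimitive_powPotential hα0 _ (ae_coordLaw_nonneg hm' e)
  have hone : ∀ t : ℝ, 0 ≤ t → (coordLaw P Ψ 0).real (Set.Iic t) = 1 := fun t ht => by
    simp [coordLaw, measureReal_def, ht]
  refine ⟨?_, fun d => ?_⟩
  · have h := hN0 0 0 le_rfl
    rw [hrel 0 0 le_rfl, hone 0 le_rfl, powPotential_zero hα0 (ae_coordLaw_nonneg hm' 0),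
      powPotential_zero hα0 (ae_coordLaw_nonneg hm' (0 + 1)), sub_self, sub_zero] at h
    exact h
  obtain ⟨q, w, l, hF, hq⟩ : ∃ q w l, IsFractionalPrimitive α (countProb P N d) q w l ∧
      ∀ t, 0 ≤ t → q t = countProb P' N' (d - 1) t - countProb P' N' d t := by
    cases d with
    | zero =>
      -- Here `P_N(0, ·) = 1 - H_0 + H_1`; the constant has Caputo derivative zero.
      refine ⟨_, _, _, ((IsFractionalPrimitive.const α 1).add
        (((hH 0).const_mul (-1)).add (hH 1))).congr fun t ht => ?_, fun t ht => ?_⟩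
      · rw [hN0 0 t ht, hrel 0 t ht, hone t ht]
        simp only [Pi.add_apply]
        ring
      · rw [hN1 0 t ht]
        simp [countProb, neg_add_eq_sub]
    | succ e =>
      -- For `d = e + 1` this is the second difference `H_e - 2 H_{e+1} + H_{e+2}`.
      refine ⟨_, _, _, ((hH e).add (((hH (e + 1)).const_mul (-2)).add (hH (e + 2)))).congr
        fun t ht => ?_, fun t ht => ?_⟩
      · rw [hN0 (e + 1) t ht, hrel e t ht, hrel (e + 1) t ht]
        simp only [Pi.add_apply]
        ring
      · have : ((e + 1 : ℕ) : ℤ) - 1 = e := by push_cast; ring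
        rw [this, hN1 e t ht, hN1 (e + 1) t ht]
        simp only [Pi.add_apply]
        ring
  have hcont : ∀ t, 0 < t → (ContinuousAt q t ↔
      ContinuousAt (fun s => countProb P' N' (d - 1) s - countProb P' N' d s) t) := fun t ht =>
    continuousAt_congr ((lt_mem_nhds ht).mono fun s hs => hq s hs.le)
  refine ⟨fun t ht => hF.absolutelyContinuousOnInterval ht,
    hF.countable.mono fun t ht h => ht.2 ((hcont t ht.1).1 h), fun t ht h => ?_⟩
  rw [← hq t ht.le]
  exact hF.hasCaputoDerivAt hα1 ht ((hcont t ht).2 h)
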